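/- Let $q,t\in\mathbb C$ with $0<|q|<1$ and $|t|>1$, and let $n,m,N,M\in\mathbb N=\{0,1,2,\dots\}$ be arbitrary. Write $(a;p)_k=\prod_{i=0}^{k-1}(1-ap^i)$, $(a;p)_\infty=\prod_{i\ge0}(1-ap^i)$, $\Delta(x)=\prod_{i<j}(x_i-x_j)$, $|\mu|=\sum_i\mu_i$, $T_{q,x}^{\mu}f(x)=f(q^{\mu_1}x_1,\dots,q^{\mu_n}x_n)$ and $T_{t,y}^{-I}=\prod_{i\in I}T_{t,y_i}^{-1}$. For $x=(x_1,\dots,x_n)$, $y=(y_1,\dots,y_m)$ define the generating series of the deformed Noumi--Sano (NS) operators $H^r_{n,m}$ by $$H_{n,m}(x,y;u;q,t)=\sum_{\mu\in\mathbb N^n}\ \sum_{I\subseteq\{1,\dots,m\}}(t^{1-n}q^mu)^{|\mu|}(-tu)^{|I|}q^{\binom{|I|}2}B_{\mu,I}(x,y)\,T_{q,x}^{\mu}T_{t,y}^{-I}=\sum_{r\ge0}u^rH^r_{n,m},$$ $$B_{\mu,I}(x,y)=\frac{\Delta(q^\mu x)}{\Delta(x)}\prod_{i,j=1}^n\frac{(tx_i/x_j;q)_{\mu_i}}{(qx_i/x_j;q)_{\mu_i}}\prod_{i\in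 I,\,j\notin I}\frac{y_i-qy_j}{y_i-y_j}\prod_{i=1}^n\Big(\prod_{j\in I}\frac{1-x_i/ty_j}{1-q^{\mu_i}x_i/y_j}\prod_{j\notin I}\frac{1-x_i/qy_j}{1-q^{\mu_i-1}x_i/y_j}\Big),$$ and the generating series of the deformed Macdonald--Ruijsenaars (MR) operators by $$D_{n,m}(x,y;u;q,t)=H_{m,n}(y,x;qu;t^{-1},q^{-1}).$$ Define the renormalised generating series $$\mathcal H_{n,m}(x,y;u)=\frac{(t^{1-n}q^mu;q)_\infty}{(tu;q)_\infty}H_{n,m}(x,y;u),\qquad \mathcal D_{n,m}(x,y;u)=\frac{(q^mt^{-n}u;t^{-1})_\infty}{(u;t^{-1})_\infty}D_{n,m}(x,y;u),$$ and, with $z=(z_1,\dots,z_N)$ and $w=(w_1,\dots,w_M)$, the meromorphic kernel function $$\Phi=\Phi_{n,m;N,M}(x,y;z,w)=\prod_{i=1}^n\prod_{j=1}^N\frac{(x_iz_j;q)_\infty}{(t^{-1}x_iz_j;q)_\infty}\prod_{i=1}^m\prod_{j=1}^M\frac{(y_iw_j;t^{-1})_\infty}{(qy_iw_j;t^{-1})_\infty}\prod_{i=1}^n\prod_{j=1}^M(1-x_iw_j)\prod_{i=1}^m\prod_{j=1}^N(1-y_iz_j).$$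 Then $$\mathcal H_{n,m}(x,y;u)\,\Phi=\mathcal H_{N,M}(z,w;u)\,\Phi\qquad\text{and}\qquad\mathcal D_{n,m}(x,y;u)\,\Phi=\mathcal D_{N,M}(z,w;u)\,\Phi,$$ where the operators on the left act on $\Phi$ as a function of $(x,y)$ and those on the right act on $\Phi$ as a function of $(z,w)$. Here the variables are non-zero and off the polar divisors of $\Phi$ and the hyperplanes on which a denominator of a coefficient function occurring in the identity vanishes. Both identities hold (i) as identities of formal power series in $u$ (the infinite products in $u$ being replaced by their Taylor series at $u=0$), and (ii) as identities of convergent series for complex $u$: the multiple series on both sides of the first identity converge absolutely and the identity holds if $tuq^k\neq1$ for all $k\ge0$, $|t^{1-n}q^mu|<1$ (required only when $n\ge1$) and $|t^{1-N}q^Mu|<1$ (required only when $N\ge1$); those of the second converge absolutely and the identity holds if $ut^{-k}\ne1$ for all $k\ge0$, $|q^mt^{-n}u|<1$ (required only when $m\ge1$) and $|q^Mt^{-N}u|<1$ (required only when $M\ge1$). -/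

import Mathlib

/-- The finite `q`-Pochhammer symbol `(a;q)_k = (1-a)(1-aq)⋯(1-aq^{k-1})`. -/
noncomputable def qPoch (a q : ℂ) (k : ℕ) : ℂ := ∏ i ∈ Finset.range k, (1 - a * q ^ i)

/-- The infinite `q`-Pochhammer symbol `(a;q)_∞` (a convergent product for `|q| < 1`). -/
noncomputable def qPochInf (a q : ℂ) : ℂ := ∏' i : ℕ, (1 - a * q ^ i)

/-- The Vandermonde product `Δ(x) = ∏_{i<j} (x_i - x_j)`. -/
noncomputable def vandermondeProd {n : ℕ} (x : Fin n → ℂ) : ℂ :=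
  ∏ i, ∏ j ∈ Finset.Ioi i, (x i - x j)

/-- The coefficient function `B_{μ,I}(x,y)` of the deformed Noumi--Sano operators. -/
noncomputable def nsCoeff (q t : ℂ) {n m : ℕ} (μ : Fin n → ℕ) (I : Finset (Fin m))
    (x : Fin n → ℂ) (y : Fin m → ℂ) : ℂ :=
  vandermondeProd (fun i => q ^ μ i * x i) / vandermondeProd x
    * (∏ i, ∏ j, qPoch (t * x i / x j) q (μ i) / qPoch (q * x i / x j) q (μ i))
    * (∏ i ∈ I, ∏ j ∈ Iᶜ, (y i - q * y j) / (y i - y j))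
    * ∏ i, ((∏ j ∈ I, (1 - x i / (t * y j)) / (1 - q ^ μ i * x i / y j))
        * ∏ j ∈ Iᶜ, (1 - x i / (q * y j)) / (1 - q ^ ((μ i : ℤ) - 1) * x i / y j))

/-- The `(μ,I)`-term of the generating series of the deformed NS operators, without its power
`u^{|μ|+|I|}` of the spectral parameter, applied to `f` at `(x,y)`:
`(t^{1-n} q^m)^{|μ|} (-t)^{|I|} q^{|I|(|I|-1)/2} B_{μ,I}(x,y) (T_{q,x}^μ T_{t,y}^{-I} f)(x,y)`. -/
noncomputable def nsTerm (q t : ℂ) {n m : ℕ} (f : (Fin n → ℂ) → (Fin m → ℂ) → ℂ)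
    (x : Fin n → ℂ) (y : Fin m → ℂ) (p : (Fin n → ℕ) × Finset (Fin m)) : ℂ :=
  (t ^ (1 - (n : ℤ)) * q ^ m) ^ (∑ i, p.1 i) * (-t) ^ p.2.card * q ^ p.2.card.choose 2
    * nsCoeff q t p.1 p.2 x y
    * f (fun i => q ^ p.1 i * x i) (fun j => if j ∈ p.2 then t⁻¹ * y j else y j)

/-- The deformed NS operator `H_{n,m}^r`, applied to `f` at `(x,y)`. -/
noncomputable def nsOp (q t : ℂ) {n m : ℕ} (r : ℕ) (f : (Fin n → ℂ) → (Fin m → ℂ) → ℂ)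
    (x : Fin n → ℂ) (y : Fin m → ℂ) : ℂ :=
  ∑ d ∈ Finset.HasAntidiagonal.antidiagonal r,
    ∑ μ ∈ Finset.piAntidiag (Finset.univ : Finset (Fin n)) d.1,
    ∑ I ∈ Finset.powersetCard d.2 (Finset.univ : Finset (Fin m)), nsTerm q t f x y (μ, I)

/-! ### The generating series as functions of a complex number `u` -/

/-- The `(μ,I)`-term of `H_{n,m}(x,y;u) f`. -/
noncomputable def nsGenTerm (q t u : ℂ) {n m : ℕ} (f : (Fin n → ℂ) → (Fin m → ℂ) → ℂ)
    (x : Fin n → ℂ) (y : Fin m → ℂ) (p : (Fin n → ℕ) × Finset (Fin m)) : ℂ :=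
  u ^ ((∑ i, p.1 i) + p.2.card) * nsTerm q t f x y p

/-- `H_{n,m}(x,y;u) f`, a sum over all `μ ∈ ℕⁿ` and `I ⊆ {1,…,m}`. -/
noncomputable def nsGen (q t u : ℂ) {n m : ℕ} (f : (Fin n → ℂ) → (Fin m → ℂ) → ℂ)
    (x : Fin n → ℂ) (y : Fin m → ℂ) : ℂ :=
  ∑' p : (Fin n → ℕ) × Finset (Fin m), nsGenTerm q t u f x y p

/-- The renormalised series `𝓗_{n,m}(x,y;u) f`. -/
noncomputable def nsGenRenorm (q t u : ℂ) {n m : ℕ} (f : (Fin n → ℂ) → (Fin m → ℂ) → ℂ)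
    (x : Fin n → ℂ) (y : Fin m → ℂ) : ℂ :=
  qPochInf (t ^ (1 - (n : ℤ)) * q ^ m * u) q / qPochInf (t * u) q * nsGen q t u f x y

/-- The terms of `D_{n,m}(x,y;u;q,t) f = H_{m,n}(y,x;qu;t⁻¹,q⁻¹) f`. -/
noncomputable def mrGenTerm (q t u : ℂ) {n m : ℕ} (f : (Fin n → ℂ) → (Fin m → ℂ) → ℂ)
    (x : Fin n → ℂ) (y : Fin m → ℂ) (p : (Fin m → ℕ) × Finset (Fin n)) : ℂ :=
  nsGenTerm t⁻¹ q⁻¹ (q * u) (fun y' x' => f x' y') y x p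

/-- The deformed Macdonald--Ruijsenaars series
`D_{n,m}(x,y;u;q,t) f = H_{m,n}(y,x;qu;t⁻¹,q⁻¹) f`. -/
noncomputable def mrGen (q t u : ℂ) {n m : ℕ} (f : (Fin n → ℂ) → (Fin m → ℂ) → ℂ)
    (x : Fin n → ℂ) (y : Fin m → ℂ) : ℂ :=
  ∑' p : (Fin m → ℕ) × Finset (Fin n), mrGenTerm q t u f x y p

/-- The renormalised series `𝓓_{n,m}(x,y;u) f`. -/
noncomputable def mrGenRenorm (q t u : ℂ) {n m : ℕ} (f : (Fin n → ℂ) → (Fin m → ℂ) → ℂ)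
    (x : Fin n → ℂ) (y : Fin m → ℂ) : ℂ :=
  qPochInf (q ^ m * t ^ (-(n : ℤ)) * u) t⁻¹ / qPochInf u t⁻¹ * mrGen q t u f x y

/-! ### The generating series as formal power series in `u` -/

/-- The Taylor series at `u = 0` of `u ↦ (a u;q)_∞`. -/
noncomputable def qPochSeries (a q : ℂ) : PowerSeries ℂ :=
  PowerSeries.mk fun r => iteratedDeriv r (fun u : ℂ => qPochInf (a * u) q) 0 / (r.factorial : ℂ)

/-- `H_{n,m}(x,y;u) f = ∑_r u^r H_{n,m}^r f` as a formal power series in `u`. -/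
noncomputable def nsSeries (q t : ℂ) {n m : ℕ} (f : (Fin n → ℂ) → (Fin m → ℂ) → ℂ)
    (x : Fin n → ℂ) (y : Fin m → ℂ) : PowerSeries ℂ :=
  PowerSeries.mk fun r => nsOp q t r f x y

/-- `𝓗_{n,m}(x,y;u) f` as a formal power series in `u`. -/
noncomputable def nsSeriesRenorm (q t : ℂ) {n m : ℕ} (f : (Fin n → ℂ) → (Fin m → ℂ) → ℂ)
    (x : Fin n → ℂ) (y : Fin m → ℂ) : PowerSeries ℂ :=
  qPochSeries (t ^ (1 - (n : ℤ)) * q ^ m) q * (qPochSeries t q)⁻¹ * nsSeries q t f x y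

/-- `D_{n,m}(x,y;u;q,t) f = H_{m,n}(y,x;qu;t⁻¹,q⁻¹) f` as a formal power series in `u`. -/
noncomputable def mrSeries (q t : ℂ) {n m : ℕ} (f : (Fin n → ℂ) → (Fin m → ℂ) → ℂ)
    (x : Fin n → ℂ) (y : Fin m → ℂ) : PowerSeries ℂ :=
  PowerSeries.rescale q (nsSeries t⁻¹ q⁻¹ (fun y' x' => f x' y') y x)

/-- `𝓓_{n,m}(x,y;u) f` as a formal power series in `u`. -/
noncomputable def mrSeriesRenorm (q t : ℂ) {n m : ℕ} (f : (Fin n → ℂ) → (Fin m → ℂ) → ℂ)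
    (x : Fin n → ℂ) (y : Fin m → ℂ) : PowerSeries ℂ :=
  qPochSeries (q ^ m * t ^ (-(n : ℤ))) t⁻¹ * (qPochSeries 1 t⁻¹)⁻¹ * mrSeries q t f x y

/-! ### The kernel function -/

/-- The kernel function `Φ_{n,m;N,M}(x,y;z,w)`. -/
noncomputable def kernelFun (q t : ℂ) {n m N M : ℕ} (x : Fin n → ℂ) (y : Fin m → ℂ)
    (z : Fin N → ℂ) (w : Fin M → ℂ) : ℂ :=
  (∏ i, ∏ j, qPochInf (x i * z j) q / qPochInf (t⁻¹ * x i * z j) q)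
    * (∏ i, ∏ j, qPochInf (y i * w j) t⁻¹ / qPochInf (q * y i * w j) t⁻¹)
    * (∏ i, ∏ j, (1 - x i * w j)) * ∏ i, ∏ j, (1 - y i * z j)

/-- The variables are non-zero and `(x,y)` is not on any of the hyperplanes where a denominator of
some coefficient `B_{μ,I}` vanishes. -/
def NSRegular (q : ℂ) {n m : ℕ} (x : Fin n → ℂ) (y : Fin m → ℂ) : Prop :=
  (∀ i, x i ≠ 0) ∧ (∀ j, y j ≠ 0) ∧
  (∀ i j, i ≠ j → ∀ k : ℕ, q ^ k * x i ≠ x j) ∧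
  (∀ i j, i ≠ j → y i ≠ y j) ∧
  (∀ i j, ∀ k : ℕ, q ^ k * x i ≠ q * y j)

/-- `(x,y;z,w)` is not on any of the polar divisors of the kernel function, i.e. none of the
denominators `(t⁻¹ x_i z_j;q)_∞` and `(q y_i w_j;t⁻¹)_∞` vanishes. -/
def KernelRegular (q t : ℂ) {n m N M : ℕ} (x : Fin n → ℂ) (y : Fin m → ℂ)
    (z : Fin N → ℂ) (w : Fin M → ℂ) : Prop :=
  (∀ i j, ∀ k : ℕ, t⁻¹ * x i * z j * q ^ k ≠ 1) ∧
  (∀ i j, ∀ k : ℕ, q * y i * w j * t⁻¹ ^ k ≠ 1)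

/-!
The identity for the Macdonald--Ruijsenaars series is the one for the Noumi--Sano series with
parameters `t⁻¹, q⁻¹, q u` and the two kinds of variables interchanged, because the kernel
function is invariant under this substitution (`kernelFun_dual`). So only the Noumi--Sano series
matter, and by Cauchy products of convergent series (`PowerSeries.HasValue.mul`,
`hasValue_nsSeries`) and absolute convergence (`summable_nsGenTerm`) it suffices to prove the
identity of formal power series in `u`.

At a generic point the coefficient of `u ^ r` in `H_{n,m} Φ` is `Φ` times a Laurent polynomial
in `t` (`kernelFun_shift`, `isLaurentPoly_coeff_nsRatioSeries`). Two Laurent polynomials agree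
once they agree at `t = q ^ (-L)` for all natural numbers `L`. For these `t` the deformed sum is
a specialization of a source sum over subsets (`subsetSum`): take as nodes the `y j` together
with the geometric strings `x i, q x i, …, q ^ (L - 1) x i`. A subset contributes only if it
meets every string in an initial segment, of length `μ i` say, and the products over the strings
telescope to the coefficients of the Noumi--Sano operators (`subsetWeight_fuse`).

The source sums attached to two groups of equally many nodes coincide (`subsetSum_symm`): the
determinant of `c / (1 - y i * w k) + 1 / (1 - q * y i * w k)` can be expanded along its rows or
along its columns, and every term is a Cauchy determinant. Groups of different sizes are treated
by adjoining nodes and letting them tend to `0`, which produces the factors of the infinite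
`q`-Pochhammer symbols (`subsetSum_eq_prod_mul`).

Points where the kernel function or a ratio of kernel functions degenerates are reached by
continuity: dilating `(z, w)` by a number close to `1` outside a countable set gives a generic
point (`dense_setOf_generic`, `nsSeries_identity`).
-/

/-! ### The infinite `q`-Pochhammer symbol -/

theorem summable_norm_mul_geometric {q : ℂ} (hq : ‖q‖ < 1) (a : ℂ) :
    Summable fun i : ℕ => ‖-(a * q ^ i)‖ := by
  simp only [norm_neg, norm_mul, norm_pow]
  exact (summable_geometric_of_lt_one (norm_nonneg _) hq).mul_left _

theorem multipliable_one_sub_mul_pow {q : ℂ} (hq : ‖q‖ < 1) (a : ℂ) :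
    Multipliable fun i : ℕ => 1 - a * q ^ i := by
  simpa only [← sub_eq_add_neg] using
    multipliable_one_add_of_summable (summable_norm_mul_geometric hq a)

theorem qPochInf_ne_zero {q : ℂ} (hq : ‖q‖ < 1) {a : ℂ} (h : ∀ i : ℕ, a * q ^ i ≠ 1) :
    qPochInf a q ≠ 0 := by
  have := tprod_one_add_ne_zero_of_summable (f := fun i : ℕ => -(a * q ^ i))
    (fun i => by rw [← sub_eq_add_neg]; exact sub_ne_zero.mpr (h i).symm)
    (summable_norm_mul_geometric hq a)
  simpa only [qPochInf, ← sub_eq_add_neg] using this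

/-- Splitting off the first `k` factors: `(a;q)_∞ = (a;q)_k (q ^ k a;q)_∞`. -/
theorem qPochInf_eq_qPoch_mul {q : ℂ} (hq : ‖q‖ < 1) (a : ℂ) (k : ℕ) :
    qPochInf a q = qPoch a q k * qPochInf (q ^ k * a) q := by
  unfold qPochInf qPoch
  have h := (multipliable_one_sub_mul_pow hq (q ^ k * a))
  have h' : Multipliable fun i : ℕ => 1 - a * q ^ (i + k) :=
    h.congr fun i => by rw [pow_add]; ring
  rw [← Multipliable.prod_mul_tprod_nat_mul' (f := fun i : ℕ => 1 - a * q ^ i) h']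
  congr 1
  exact tprod_congr fun i => by rw [pow_add]; ring

theorem differentiable_qPochInf {q : ℂ} (hq : ‖q‖ < 1) :
    Differentiable ℂ fun a => qPochInf a q := by
  have h : HasProdLocallyUniformlyOn (fun (i : ℕ) (a : ℂ) => 1 + -(a * q ^ i))
      (fun a => ∏' i : ℕ, (1 + -(a * q ^ i))) Set.univ := by
    apply hasProdLocallyUniformlyOn_of_forall_compact isOpen_univ
    intro K _ hK
    obtain ⟨C, hC⟩ := hK.isBounded.exists_norm_le
    refine ((summable_geometric_of_lt_one (norm_nonneg _) hq).mul_left C).hasProdUniformlyOn_one_add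
      hK (.of_forall fun i a ha => ?_) (fun _ => by fun_prop)
    rw [norm_neg, norm_mul, norm_pow]
    exact mul_le_mul_of_nonneg_right (hC a ha) (by positivity)
  have hd := h.differentiableOn (.of_forall fun _ => by
    simpa [Finset.prod_fn] using DifferentiableOn.finsetProd (fun _ _ => by fun_prop)) isOpen_univ
  have := differentiableOn_univ.mp hd
  simpa only [qPochInf, sub_eq_add_neg] using this

theorem continuous_qPochInf {q : ℂ} (hq : ‖q‖ < 1) : Continuous fun a => qPochInf a q :=
  (differentiable_qPochInf hq).continuous

theorem qPochInf_zero (q : ℂ) : qPochInf 0 q = 1 := by simp [qPochInf]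

/-! ### Power series and their values -/

/-- The formal power series `A`, evaluated at the number `u`, converges with sum `a`. -/
def PowerSeries.HasValue (A : PowerSeries ℂ) (u a : ℂ) : Prop :=
  HasSum (fun r => PowerSeries.coeff r A * u ^ r) a

theorem PowerSeries.HasValue.mul {A B : PowerSeries ℂ} {u a b : ℂ} (hA : A.HasValue u a)
    (hB : B.HasValue u b) : (A * B).HasValue u (a * b) := by
  unfold PowerSeries.HasValue at *
  have e : (fun r => PowerSeries.coeff r (A * B) * u ^ r) = fun r =>
      ∑ p ∈ Finset.HasAntidiagonal.antidiagonal r, (PowerSeries.coeff p.1 A * u ^ p.1)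
        * (PowerSeries.coeff p.2 B * u ^ p.2) := by
    funext r
    rw [PowerSeries.coeff_mul, Finset.sum_mul]
    refine Finset.sum_congr rfl fun p hp => ?_
    rw [← Finset.HasAntidiagonal.mem_antidiagonal.mp hp, pow_add]; ring
  rw [e, ← hA.tsum_eq, ← hB.tsum_eq,
    tsum_mul_tsum_eq_tsum_sum_antidiagonal_of_summable_norm hA.summable.norm hB.summable.norm]
  exact (summable_norm_sum_mul_antidiagonal_of_summable_norm hA.summable.norm
    hB.summable.norm).of_norm.hasSum

theorem PowerSeries.HasValue.rescale {A : PowerSeries ℂ} {u a c : ℂ} (h : A.HasValue (c * u) a) :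
    (PowerSeries.rescale c A).HasValue u a := by
  unfold PowerSeries.HasValue at *
  convert h using 2 with r
  rw [PowerSeries.coeff_rescale, mul_pow]; ring

/-- A formal power series that converges everywhere is determined by its sum. -/
theorem PowerSeries.eq_of_hasValue {A B : PowerSeries ℂ} {F : ℂ → ℂ}
    (hA : ∀ u, A.HasValue u (F u)) (hB : ∀ u, B.HasValue u (F u)) : A = B := by
  have h : ∀ C : PowerSeries ℂ, (∀ u, C.HasValue u (F u)) →
      HasFPowerSeriesAt F
        (FormalMultilinearSeries.ofScalars ℂ fun r => PowerSeries.coeff r C) 0 := by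
    intro C hC
    rw [hasFPowerSeriesAt_iff]
    refine Filter.Eventually.of_forall fun z => ?_
    have := hC z
    unfold PowerSeries.HasValue at this
    simpa [mul_comm] using this
  have := (h A hA).eq_formalMultilinearSeries (h B hB)
  rw [FormalMultilinearSeries.ofScalars_series_eq_iff] at this
  ext r
  exact congrFun this r

theorem hasValue_qPochSeries {q : ℂ} (hq : ‖q‖ < 1) (a u : ℂ) :
    (qPochSeries a q).HasValue u (qPochInf (a * u) q) := by
  have hd : Differentiable ℂ fun u : ℂ => qPochInf (a * u) q :=
    (differentiable_qPochInf hq).comp (differentiable_id.const_mul a)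
  have := Complex.hasSum_taylorSeries_of_entire hd 0 u
  unfold PowerSeries.HasValue qPochSeries
  rw [show (fun r => PowerSeries.coeff r (PowerSeries.mk fun r =>
      iteratedDeriv r (fun u : ℂ => qPochInf (a * u) q) 0 / (r.factorial : ℂ)) * u ^ r)
      = fun n : ℕ => (n.factorial : ℂ)⁻¹ • (u - 0) ^ n
        • iteratedDeriv n (fun u => qPochInf (a * u) q) 0 from funext fun r => by
    rw [PowerSeries.coeff_mk, sub_zero, smul_eq_mul, smul_eq_mul]
    ring]
  exact this

theorem qPochSeries_eq_rescale {q : ℂ} (hq : ‖q‖ < 1) (a : ℂ) :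
    qPochSeries a q = PowerSeries.rescale a (qPochSeries 1 q) :=
  PowerSeries.eq_of_hasValue (hasValue_qPochSeries hq a) fun u =>
    (by simpa using hasValue_qPochSeries hq 1 (a * u) :
      (qPochSeries 1 q).HasValue (a * u) _).rescale

/-! ### Products over pairs -/

open Finset in
/-- Splitting a product over all ordered pairs into the diagonal and the pairs `i < j`. -/
theorem prod_prod_eq_prod_diag_mul_prod_Ioi {n : ℕ} {R : Type*} [CommMonoid R]
    (G : Fin n → Fin n → R) :
    ∏ i, ∏ j, G i j = (∏ i, G i i) * ∏ i, ∏ j ∈ Ioi i, (G i j * G j i) := by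
  have h1 : ∀ i, ∏ j, G i j = G i i * ((∏ j ∈ Ioi i, G i j) * ∏ j ∈ Iio i, G i j) := by
    intro i
    rw [← Finset.prod_union (by
      rw [Finset.disjoint_left]; intro a; simp only [mem_Ioi, mem_Iio]; intro h h'
      exact lt_asymm h h')]
    rw [← Finset.prod_insert (by simp)]
    congr 1
    ext j
    simp only [mem_univ, mem_insert, mem_union, mem_Ioi, mem_Iio, true_iff]
    rcases lt_trichotomy i j with h | h | h
    · exact Or.inr (Or.inl h)
    · exact Or.inl h.symm
    · exact Or.inr (Or.inr h)
  simp only [h1, Finset.prod_mul_distrib]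
  congr 2
  rw [Finset.prod_comm' (s := univ) (t := fun i => Iio i) (t' := univ) (s' := fun i => Ioi i)]
  simp

/-- The additive form of the splitting into diagonal and off-diagonal pairs, for binomial
coefficients. -/
theorem choose_two_sum {n : ℕ} (μ : Fin n → ℕ) :
    (∑ i, μ i).choose 2 = ∑ i, (μ i).choose 2 + ∑ i, ∑ j ∈ Finset.Ioi i, μ i * μ j := by
  have key := prod_prod_eq_prod_diag_mul_prod_Ioi (R := Multiplicative ℕ)
    (fun i j => Multiplicative.ofAdd (μ i * μ j))
  have key' : ∑ i, ∑ j, μ i * μ j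
      = ∑ i, μ i * μ i + ∑ i, ∑ j ∈ Finset.Ioi i, (μ i * μ j + μ j * μ i) := key
  have h2 : ∀ k : ℕ, 2 * k.choose 2 + k = k * k := by
    intro k
    induction k with
    | zero => rfl
    | succ k ih => rw [Nat.choose_succ_succ' k 1, Nat.choose_one_right]; nlinarith
  have e1 : ∑ i, ∑ j, μ i * μ j = (∑ i, μ i) * (∑ i, μ i) := by rw [Finset.sum_mul_sum]
  have e2 : ∑ i, μ i * μ i = 2 * ∑ i, (μ i).choose 2 + ∑ i, μ i := by
    rw [Finset.mul_sum, ← Finset.sum_add_distrib]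
    exact Finset.sum_congr rfl fun i _ => (h2 _).symm
  have e3 : ∑ i, ∑ j ∈ Finset.Ioi i, (μ i * μ j + μ j * μ i)
      = 2 * ∑ i, ∑ j ∈ Finset.Ioi i, μ i * μ j := by
    simp only [Finset.mul_sum]
    exact Finset.sum_congr rfl fun i _ => Finset.sum_congr rfl fun j _ => by ring
  have := h2 (∑ i, μ i)
  omega

/-! ### The source identity for equally many nodes -/

/-- The weight, apart from the power of `-v`, of a set `I` of nodes in the source sum `subsetSum`.
The products run over all of `ι` with a case distinction, which makes reindexing along equivalences
and along sum types mechanical. -/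
noncomputable def subsetWeight (q : ℂ) {ι κ : Type*} [Fintype ι] [DecidableEq ι] [Fintype κ]
    (Y : ι → ℂ) (W : κ → ℂ) (I : Finset ι) : ℂ :=
  q ^ I.card.choose 2
    * (∏ a, ∏ b, if a ∈ I ∧ b ∉ I then (Y a - q * Y b) / (Y a - Y b) else 1)
    * ∏ a, ∏ k, if a ∈ I then (1 - q * Y a * W k) / (1 - Y a * W k) else 1

/-- The source sum
`∑_I (-v)^|I| q^(|I| choose 2) ∏_{a ∈ I, b ∉ I} (Y_a - q Y_b) / (Y_a - Y_b)
∏_{a ∈ I, k} (1 - q Y_a W_k) / (1 - Y_a W_k)` over the sets `I` of nodes. -/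
noncomputable def subsetSum (q : ℂ) {ι κ : Type*} [Fintype ι] [DecidableEq ι] [Fintype κ]
    (Y : ι → ℂ) (W : κ → ℂ) (v : ℂ) : ℂ :=
  ∑ I : Finset ι, (-v) ^ I.card * subsetWeight q Y W I

theorem subsetSum_comp_equiv (q : ℂ) {ι κ ι' κ' : Type*} [Fintype ι] [DecidableEq ι] [Fintype κ]
    [Fintype ι'] [DecidableEq ι'] [Fintype κ'] (e : ι' ≃ ι) (e' : κ' ≃ κ)
    (Y : ι → ℂ) (W : κ → ℂ) (v : ℂ) :
    subsetSum q (Y ∘ e) (W ∘ e') v = subsetSum q Y W v := by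
  unfold subsetSum
  refine Fintype.sum_equiv e.finsetCongr _ _ fun I => ?_
  unfold subsetWeight
  simp only [Equiv.finsetCongr_apply, Finset.card_map]
  congr 1
  congr 1
  · congr 1
    rw [← Equiv.prod_comp e]
    refine Finset.prod_congr rfl fun a _ => ?_
    rw [← Equiv.prod_comp e]
    refine Finset.prod_congr rfl fun b _ => ?_
    simp
  · rw [← Equiv.prod_comp e]
    refine Finset.prod_congr rfl fun a _ => ?_
    rw [← Equiv.prod_comp e']
    refine Finset.prod_congr rfl fun b _ => ?_
    simp

/-- The Cauchy matrix factors through the Vandermonde matrix of `y`: clearing the denominators of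
row `i` leaves the values at `y i` of the polynomials `∏_{l ≠ k} (1 - X w l)`. -/
theorem exists_det_cauchy_eq {m : ℕ} (w : Fin m → ℂ) (hw : Function.Injective w)
    (hw0 : ∀ k, w k ≠ 0) :
    ∃ c : ℂ, c ≠ 0 ∧ ∀ y : Fin m → ℂ, (∀ i k, 1 - y i * w k ≠ 0) →
      (Matrix.of fun i k => 1 / (1 - y i * w k)).det
        = (Matrix.vandermonde y).det * c * ∏ i, ∏ k, (1 - y i * w k)⁻¹ := by
  classical
  let P : Fin m → Polynomial ℂ := fun k =>
    ∏ l ∈ Finset.univ.erase k, (1 - Polynomial.X * Polynomial.C (w l))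
  have hPe : ∀ k y, (P k).eval y = ∏ l ∈ Finset.univ.erase k, (1 - y * w l) := by
    intro k y
    simp only [P, Polynomial.eval_prod, Polynomial.eval_sub, Polynomial.eval_one,
      Polynomial.eval_mul, Polynomial.eval_X, Polynomial.eval_C]
  have hdeg : ∀ k, (P k).natDegree < m := by
    intro k
    have h1 : (P k).natDegree ≤ ∑ l ∈ Finset.univ.erase k, 1 := by
      refine (Polynomial.natDegree_prod_le _ _).trans (Finset.sum_le_sum fun l _ => ?_)
      refine (Polynomial.natDegree_sub_le _ _).trans ?_
      simp only [Polynomial.natDegree_one]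
      refine max_le (by norm_num) ?_
      exact Polynomial.natDegree_mul_C_le _ _ |>.trans Polynomial.natDegree_X_le
    have h2 : (Finset.univ.erase k).card < m := by
      have := Finset.card_erase_lt_of_mem (Finset.mem_univ k)
      simpa using this
    simp only [Finset.sum_const, smul_eq_mul, mul_one] at h1
    omega
  let Q : Matrix (Fin m) (Fin m) ℂ := Matrix.of fun j k => (P k).coeff j
  have hV : ∀ y : Fin m → ℂ,
      (Matrix.of fun i k => (P k).eval (y i)) = Matrix.vandermonde y * Q := by
    intro y
    ext i k
    simp only [Matrix.of_apply, Matrix.mul_apply, Matrix.vandermonde_apply, Q]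
    rw [Polynomial.eval_eq_sum_range' (hdeg k), ← Fin.sum_univ_eq_sum_range
      (fun j => (P k).coeff j * y i ^ j)]
    exact Finset.sum_congr rfl fun j _ => mul_comm _ _
  refine ⟨Q.det, ?_, ?_⟩
  · -- at `y = 1 / w` the matrix of values is diagonal with non-zero entries
    have hD : (Matrix.of fun i k => (P k).eval ((w i)⁻¹))
        = Matrix.diagonal fun k => (P k).eval ((w k)⁻¹) := by
      ext i k
      by_cases h : i = k
      · subst h; simp
      · rw [Matrix.diagonal_apply_ne _ h, Matrix.of_apply, hPe]
        refine Finset.prod_eq_zero (i := i) (by simp [h]) ?_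
        rw [inv_mul_cancel₀ (hw0 i), sub_self]
    have h1 : (Matrix.diagonal fun k => (P k).eval ((w k)⁻¹)).det ≠ 0 := by
      rw [Matrix.det_diagonal]
      refine Finset.prod_ne_zero_iff.mpr fun k _ => ?_
      rw [hPe]
      refine Finset.prod_ne_zero_iff.mpr fun l hl => ?_
      intro h
      apply (Finset.mem_erase.mp hl).1
      apply hw
      have := hw0 k
      field_simp at h
      linear_combination -h
    rw [← hD, hV, Matrix.det_mul] at h1
    exact right_ne_zero_of_mul h1
  · intro y hy
    have h1 : (Matrix.of fun i k => 1 / (1 - y i * w k))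
        = Matrix.of fun i k => (∏ l, (1 - y i * w l)⁻¹)
            * (Matrix.of fun i k => (P k).eval (y i)) i k := by
      ext i k
      simp only [Matrix.of_apply]
      rw [hPe, ← Finset.mul_prod_erase _ _ (Finset.mem_univ k), mul_assoc,
        ← Finset.prod_mul_distrib, Finset.prod_eq_one, one_div, mul_one]
      intro l _
      exact inv_mul_cancel₀ (hy i l)
    rw [h1, Matrix.det_mul_column, hV, Matrix.det_mul, mul_comm]

/-- The effect on the Vandermonde product of multiplying by `q` the variables outside `I`. -/
theorem det_vandermonde_piecewise (q : ℂ) {m : ℕ} (y : Fin m → ℂ) (hy : Function.Injective y)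
    (I : Finset (Fin m)) :
    (q ^ (m - 1)) ^ I.card * (Matrix.vandermonde fun i => if i ∈ I then y i else q * y i).det
      = (Matrix.vandermonde fun i => q * y i).det * (q ^ I.card.choose 2
        * ∏ a, ∏ b, if a ∈ I ∧ b ∉ I then (y a - q * y b) / (y a - y b) else 1) := by
  classical
  rw [Matrix.det_vandermonde, Matrix.det_vandermonde, prod_prod_eq_prod_diag_mul_prod_Ioi]
  -- the powers of `q` are distributed over the pairs by means of the indicator function of `I`
  let e : Fin m → ℕ := fun i => if i ∈ I then 1 else 0
  have he : ∑ i, e i = I.card := by simp [e]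
  have h2 : q ^ I.card.choose 2 = ∏ i, ∏ j ∈ Finset.Ioi i, q ^ (e i * e j) := by
    rw [← he, choose_two_sum]
    have : ∑ i, (e i).choose 2 = 0 := Finset.sum_eq_zero fun i _ => by
      simp only [e]; split_ifs <;> rfl
    rw [this, zero_add, ← Finset.prod_pow_eq_pow_sum]
    exact Finset.prod_congr rfl fun i _ => (Finset.prod_pow_eq_pow_sum _ _ _).symm
  have h1 : (q ^ (m - 1)) ^ I.card = ∏ i, ∏ j ∈ Finset.Ioi i, q ^ (e i + e j) := by
    have key := prod_prod_eq_prod_diag_mul_prod_Ioi (R := Multiplicative ℕ)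
      (fun i _ : Fin m => Multiplicative.ofAdd (e i))
    have key' : ∑ i, ∑ _j : Fin m, e i
      = ∑ i, e i + ∑ i, ∑ j ∈ Finset.Ioi i, (e i + e j) := key
    rw [he] at key'
    simp only [Finset.sum_const, Finset.card_univ, Fintype.card_fin, smul_eq_mul,
      ← Finset.mul_sum, he] at key'
    have : ∑ i, ∑ j ∈ Finset.Ioi i, (e i + e j) = (m - 1) * I.card := by
      rw [Nat.sub_mul, key', one_mul, Nat.add_sub_cancel_left]
    rw [← pow_mul, ← this, ← Finset.prod_pow_eq_pow_sum]
    exact Finset.prod_congr rfl fun i _ => (Finset.prod_pow_eq_pow_sum _ _ _).symm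
  rw [h1, h2]
  have h3 : (∏ i, if i ∈ I ∧ i ∉ I then (y i - q * y i) / (y i - y i) else (1 : ℂ)) = 1 :=
    Finset.prod_eq_one fun i _ => by rw [if_neg]; tauto
  rw [h3, one_mul]
  simp only [← Finset.prod_mul_distrib]
  refine Finset.prod_congr rfl fun i _ => Finset.prod_congr rfl fun j hj => ?_
  have hij : i ≠ j := (Finset.mem_Ioi.mp hj).ne
  have h4 : y i - y j ≠ 0 := sub_ne_zero.mpr fun h => hij (hy h)
  have h5 : y j - y i ≠ 0 := sub_ne_zero.mpr fun h => hij (hy h).symm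
  by_cases hi : i ∈ I <;> by_cases hj : j ∈ I <;> simp [e, hi, hj]
  · ring
  · field_simp; ring
  · field_simp

/-- Up to a Cauchy determinant, the source sum is the determinant of a sum of two Cauchy matrices:
expand the latter multilinearly in the rows. -/
theorem subsetSum_mul_det (q : ℂ) {m : ℕ} (y w : Fin m → ℂ) (hy : Function.Injective y)
    (hw : Function.Injective w) (hw0 : ∀ k, w k ≠ 0) (h1 : ∀ i k, 1 - y i * w k ≠ 0)
    (h2 : ∀ i k, 1 - q * y i * w k ≠ 0) (v : ℂ) :
    (Matrix.of fun i k => 1 / (1 - q * y i * w k)).det * subsetSum q y w v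
      = (Matrix.of fun i k => -v * q ^ (m - 1) * (1 / (1 - y i * w k))
          + 1 / (1 - q * y i * w k)).det := by
  classical
  obtain ⟨c, -, hc⟩ := exists_det_cauchy_eq w hw hw0
  have hexp := (Matrix.detRowAlternating (R := ℂ) (n := Fin m)).toMultilinearMap.map_add_univ
    (fun i k => -v * q ^ (m - 1) * (1 / (1 - y i * w k))) (fun i k => 1 / (1 - q * y i * w k))
  change (Matrix.of fun i k => -v * q ^ (m - 1) * (1 / (1 - y i * w k))
          + 1 / (1 - q * y i * w k)).det = _ at hexp
  rw [hexp, subsetSum, Finset.mul_sum]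
  refine Finset.sum_congr rfl fun I _ => ?_
  have hr : (Matrix.detRowAlternating (R := ℂ) (n := Fin m)).toMultilinearMap
      (I.piecewise (fun i k => -v * q ^ (m - 1) * (1 / (1 - y i * w k)))
        (fun i k => 1 / (1 - q * y i * w k)))
      = (Matrix.of fun i k => (if i ∈ I then -v * q ^ (m - 1) else 1)
          * (Matrix.of fun i k => 1 / (1 - (if i ∈ I then y i else q * y i) * w k)) i k).det := by
    change Matrix.det _ = _
    congr 1
    ext i k
    by_cases hi : i ∈ I <;> simp [hi]
  rw [hr, Matrix.det_mul_column, hc (fun i => if i ∈ I then y i else q * y i)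
      (fun i k => by split_ifs; exacts [h1 i k, h2 i k]), hc (fun i => q * y i) h2, subsetWeight]
  have hp : (∏ i, if i ∈ I then -v * q ^ (m - 1) else (1 : ℂ))
      = (-v) ^ I.card * (q ^ (m - 1)) ^ I.card := by
    rw [Finset.prod_ite_mem, Finset.univ_inter, Finset.prod_const, mul_pow]
  have hk : ∏ i, ∏ k, (1 - (if i ∈ I then y i else q * y i) * w k)⁻¹
      = (∏ i, ∏ k, (1 - q * y i * w k)⁻¹)
        * ∏ i, ∏ k, if i ∈ I then (1 - q * y i * w k) / (1 - y i * w k) else 1 := by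
    simp only [← Finset.prod_mul_distrib]
    refine Finset.prod_congr rfl fun i _ => Finset.prod_congr rfl fun k _ => ?_
    have := h1 i k
    have := h2 i k
    by_cases hi : i ∈ I
    · simp only [hi, if_true]
      rw [← mul_div_assoc, inv_mul_cancel₀ this, one_div]
    · simp [hi]
  rw [hp, hk]
  linear_combination (-(-v) ^ I.card * c * (∏ i, ∏ k, (1 - q * y i * w k)⁻¹)
        * ∏ i, ∏ k, if i ∈ I then (1 - q * y i * w k) / (1 - y i * w k) else 1)
        * det_vandermonde_piecewise q y hy I

/-- The source sum for equally many nodes is symmetric, since transposition exchanges the roles of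
`y` and `w` in the determinants. -/
theorem subsetSum_symm (q : ℂ) (hq : q ≠ 0) {m : ℕ} (y w : Fin m → ℂ) (hy : Function.Injective y)
    (hw : Function.Injective w) (hy0 : ∀ k, y k ≠ 0) (hw0 : ∀ k, w k ≠ 0)
    (h1 : ∀ i k, 1 - y i * w k ≠ 0)
    (h2 : ∀ i k, 1 - q * y i * w k ≠ 0) (v : ℂ) :
    subsetSum q y w v = subsetSum q w y v := by
  have hdet : (Matrix.of fun i k => 1 / (1 - q * y i * w k)).det ≠ 0 := by
    obtain ⟨c, hc0, hc⟩ := exists_det_cauchy_eq w hw hw0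
    rw [hc _ h2]
    refine mul_ne_zero (mul_ne_zero ?_ hc0) ?_
    · rw [Matrix.det_vandermonde_ne_zero_iff]
      exact fun i j h => hy (mul_left_cancel₀ hq h)
    · exact Finset.prod_ne_zero_iff.mpr fun i _ => Finset.prod_ne_zero_iff.mpr fun k _ =>
        inv_ne_zero (h2 i k)
  apply mul_left_cancel₀ hdet
  rw [subsetSum_mul_det q y w hy hw hw0 h1 h2]
  have e : ∀ i k, q * y i * w k = q * w k * y i := fun i k => by ring
  have e' : ∀ i k, y i * w k = w k * y i := fun i k => mul_comm _ _
  have h := subsetSum_mul_det q w y hw hy hy0 (fun i k => by rw [← e']; exact h1 k i)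
    (fun i k => by rw [← e]; exact h2 k i) v
  rw [← Matrix.det_transpose, ← Matrix.det_transpose
    (Matrix.of fun i k => -v * q ^ (m - 1) * (1 / (1 - w i * y k)) + 1 / (1 - q * w i * y k))] at h
  have t1 : (Matrix.of fun i k => 1 / (1 - q * w i * y k)).transpose
      = Matrix.of fun i k => 1 / (1 - q * y i * w k) := by
    ext i k; simp [e]
  have t2 : (Matrix.of fun i k => -v * q ^ (m - 1) * (1 / (1 - w i * y k))
      + 1 / (1 - q * w i * y k)).transpose
      = Matrix.of fun i k => -v * q ^ (m - 1) * (1 / (1 - y i * w k))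
          + 1 / (1 - q * y i * w k) := by
    ext i k; simp [e, e']
  rw [t1, t2] at h
  exact h.symm

/-! ### The source identity for different numbers of nodes -/

/-- Subsets of `Option κ` are subsets of `κ` with or without the extra point. -/
theorem sum_finset_option {κ : Type*} [Fintype κ] [DecidableEq κ] (f : Finset (Option κ) → ℂ) :
    ∑ J, f J = ∑ J : Finset κ, (f (J.map Function.Embedding.some) + f (Finset.insertNone J)) := by
  classical
  rw [← Finset.sum_filter_add_sum_filter_not Finset.univ (fun J : Finset (Option κ) => none ∉ J),
    Finset.sum_add_distrib]
  congr 1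
  · refine Finset.sum_nbij' Finset.eraseNone (fun J => J.map Function.Embedding.some) ?_ ?_ ?_ ?_ ?_
    · simp
    · simp
    · intro J hJ; simp at hJ; rw [Finset.map_some_eraseNone, Finset.erase_eq_of_notMem hJ]
    · simp
    · intro J hJ; simp at hJ; rw [Finset.map_some_eraseNone, Finset.erase_eq_of_notMem hJ]
  · refine Finset.sum_nbij' Finset.eraseNone (fun J => Finset.insertNone J) ?_ ?_ ?_ ?_ ?_
    · simp
    · simp
    · intro J hJ; simp at hJ; rw [Finset.insertNone_eraseNone, Finset.insert_eq_of_mem hJ]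
    · simp
    · intro J hJ; simp at hJ; rw [Finset.insertNone_eraseNone, Finset.insert_eq_of_mem hJ]

/-- Adjoining the point `0` to `Y` multiplies the sum by `1 - v q ^ card ι`. -/
theorem subsetSum_option_zero (q : ℂ) {ι κ : Type*} [Fintype ι] [DecidableEq ι] [Fintype κ]
    (Y : ι → ℂ) (W : κ → ℂ) (hY0 : ∀ k, Y k ≠ 0) (v : ℂ) :
    subsetSum q (fun o : Option ι => o.elim 0 Y) W v
      = (1 - v * q ^ Fintype.card ι) * subsetSum q Y W v := by
  unfold subsetSum
  rw [sum_finset_option, Finset.mul_sum]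
  refine Finset.sum_congr rfl fun J _ => ?_
  have hw1 : subsetWeight q (fun o : Option ι => o.elim 0 Y) W (J.map Function.Embedding.some)
      = subsetWeight q Y W J := by
    simp only [subsetWeight, Fintype.prod_option, Finset.card_map]
    simp [hY0]
  have hw2 : subsetWeight q (fun o : Option ι => o.elim 0 Y) W (Finset.insertNone J)
      = q ^ Fintype.card ι * subsetWeight q Y W J := by
    simp only [subsetWeight, Fintype.prod_option, Finset.card_insertNone]
    have h1 : (∏ b, if b ∈ J then (1 : ℂ) else q) = q ^ (Fintype.card ι - J.card) := by
      rw [← Finset.prod_filter_mul_prod_filter_not Finset.univ (fun b => b ∈ J)]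
      rw [Finset.prod_congr rfl (g := fun _ => (1 : ℂ)) (fun b hb => by
        rw [if_pos (Finset.mem_filter.mp hb).2]),
        Finset.prod_congr (s₁ := Finset.univ.filter (fun b => b ∉ J)) rfl (g := fun _ => q)
        (fun b hb => by rw [if_neg (Finset.mem_filter.mp hb).2])]
      simp only [Finset.prod_const_one, one_mul, Finset.prod_const]
      congr 1
      rw [← Finset.card_compl]
      congr 1
      ext; simp
    have h2 : ∀ b, (0 - q * Y b) / (0 - Y b) = q := fun b => by
      have := hY0 b; rw [zero_sub, zero_sub, neg_div_neg_eq]; field_simp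
    have h3 : q ^ (J.card + 1).choose 2 * q ^ (Fintype.card ι - J.card)
        = q ^ Fintype.card ι * q ^ J.card.choose 2 := by
      rw [← pow_add, ← pow_add]
      congr 1
      have : J.card ≤ Fintype.card ι := Finset.card_le_univ J
      rw [Nat.choose_succ_succ' J.card 1, Nat.choose_one_right, one_add_one_eq_two]
      omega
    simp only [Finset.some_mem_insertNone, Finset.none_mem_insertNone, Option.elim, true_and,
      not_true_eq_false, if_false, and_false, one_mul, h2, mul_zero, zero_mul, sub_zero, div_one,
      ite_true, Finset.prod_const_one]
    have h4 : (∏ b, if b ∉ J then q else (1 : ℂ)) = q ^ (Fintype.card ι - J.card) := by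
      rw [← h1]; exact Finset.prod_congr rfl fun b _ => by split_ifs <;> simp_all
    rw [h4]
    linear_combination (∏ a, ∏ b, if a ∈ J ∧ b ∉ J then (Y a - q * Y b) / (Y a - Y b) else 1)
      * (∏ a, ∏ k, if a ∈ J then (1 - q * Y a * W k) / (1 - Y a * W k) else 1) * h3
  rw [hw1, hw2, Finset.card_map, Finset.card_insertNone]
  ring

theorem subsetSum_option_zero_right (q : ℂ) {ι κ : Type*} [Fintype ι] [DecidableEq ι] [Fintype κ]
    (Y : ι → ℂ) (W : κ → ℂ) (v : ℂ) :
    subsetSum q Y (fun o : Option κ => o.elim 0 W) v = subsetSum q Y W v := by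
  simp [subsetSum, subsetWeight, Fintype.prod_option]

theorem continuousAt_subsetSum (q : ℂ) {ι κ : Type*} [Fintype ι] [DecidableEq ι] [Fintype κ]
    (Y : ℂ → ι → ℂ) (W : ℂ → κ → ℂ) (v s : ℂ) (hY : ∀ i, ContinuousAt (fun s => Y s i) s)
    (hW : ∀ i, ContinuousAt (fun s => W s i) s) (hinj : Function.Injective (Y s))
    (h1 : ∀ i k, 1 - Y s i * W s k ≠ 0) :
    ContinuousAt (fun s => subsetSum q (Y s) (W s) v) s := by
  unfold subsetSum subsetWeight
  refine tendsto_finsetSum _ fun I _ => ?_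
  refine ContinuousAt.mul continuousAt_const ((continuousAt_const.mul ?_).mul ?_)
  · refine tendsto_finsetProd _ fun a _ => tendsto_finsetProd _ fun b _ => ?_
    by_cases h : a ∈ I ∧ b ∉ I
    · simp only [if_pos h]
      refine ContinuousAt.div ((hY a).sub (continuousAt_const.mul (hY b))) ((hY a).sub (hY b)) ?_
      refine sub_ne_zero.mpr fun hab => h.2 ?_
      rw [← hinj hab]; exact h.1
    · simp only [if_neg h]; exact tendsto_const_nhds
  · refine tendsto_finsetProd _ fun a _ => tendsto_finsetProd _ fun b _ => ?_
    by_cases h : a ∈ I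
    · simp only [if_pos h]
      exact ContinuousAt.div (continuousAt_const.sub ((continuousAt_const.mul (hY a)).mul (hW b)))
        (continuousAt_const.sub ((hY a).mul (hW b))) (h1 a b)
    · simp only [if_neg h]; exact tendsto_const_nhds

/-- The two sums agree up to a finite product when `W` has `d` points less than `Y`: points of `W`
are adjoined and moved to `0`. -/
theorem subsetSum_eq_prod_mul (q : ℂ) (hq : q ≠ 0) (d : ℕ) {ι κ : Type*} [Fintype ι]
    [DecidableEq ι] [Fintype κ] [DecidableEq κ] (hd : Fintype.card ι = Fintype.card κ + d)
    (Y : ι → ℂ) (W : κ → ℂ) (hY : Function.Injective Y)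
    (hW : Function.Injective W) (hY0 : ∀ k, Y k ≠ 0) (hW0 : ∀ k, W k ≠ 0)
    (h1 : ∀ i k, 1 - Y i * W k ≠ 0) (h2 : ∀ i k, 1 - q * Y i * W k ≠ 0) (v : ℂ) :
    subsetSum q Y W v
      = (∏ k ∈ Finset.range d, (1 - v * q ^ (Fintype.card κ + k))) * subsetSum q W Y v := by
  induction d generalizing κ with
  | zero =>
    have e := Fintype.equivFinOfCardEq hd
    have e' := Fintype.equivFin κ
    rw [Finset.prod_range_zero, one_mul, ← subsetSum_comp_equiv q e.symm e'.symm,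
      ← subsetSum_comp_equiv q e'.symm e.symm]
    exact subsetSum_symm q hq _ _ (hY.comp e.symm.injective) (hW.comp e'.symm.injective)
      (fun k => hY0 _) (fun k => hW0 _) (fun i k => h1 _ _) (fun i k => h2 _ _) v
  | succ d ih =>
    have key : ∀ᶠ s in nhdsWithin (0 : ℂ) {0}ᶜ,
        subsetSum q Y (fun o : Option κ => o.elim s W) v
        = (∏ k ∈ Finset.range d, (1 - v * q ^ (Fintype.card κ + 1 + k)))
          * subsetSum q (fun o : Option κ => o.elim s W) Y v := by
      have c1 : ∀ᶠ s in nhds (0 : ℂ), ∀ k, s ≠ W k :=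
        Filter.eventually_all.mpr fun k =>
          continuousAt_id.eventually_ne (hW0 k).symm
      have c2 : ∀ᶠ s in nhds (0 : ℂ), ∀ i, 1 - Y i * s ≠ 0 := Filter.eventually_all.mpr fun i =>
          ContinuousAt.eventually_ne (by fun_prop) (by simp)
      have c3 : ∀ᶠ s in nhds (0 : ℂ), ∀ i, 1 - q * Y i * s ≠ 0 :=
        Filter.eventually_all.mpr fun i => ContinuousAt.eventually_ne (by fun_prop) (by simp)
      filter_upwards [nhdsWithin_le_nhds c1, nhdsWithin_le_nhds c2, nhdsWithin_le_nhds c3,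
        self_mem_nhdsWithin] with s hs1 hs2 hs3 hs0
      have := ih (κ := Option κ) (by rw [hd, Fintype.card_option]; ring) (fun o => o.elim s W)
        (by
          rintro (_ | a) (_ | b) h
          · rfl
          · exact absurd h (hs1 b)
          · exact absurd h.symm (hs1 a)
          · exact congrArg some (hW h))
        (by rintro (_ | a); exacts [hs0, hW0 a])
        (by rintro i (_ | a); exacts [hs2 i, h1 i a])
        (by rintro i (_ | a); exacts [hs3 i, h2 i a])
      rw [this, Fintype.card_option]
    have hc : ∀ o : Option κ, ContinuousAt (fun s : ℂ => o.elim s W) 0 := by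
      rintro (_ | a)
      · exact continuousAt_id
      · exact continuousAt_const
    have hinj : Function.Injective (fun o : Option κ => o.elim 0 W) := by
      rintro (_ | a) (_ | b) h
      · rfl
      · exact absurd h.symm (hW0 b)
      · exact absurd h (hW0 a)
      · exact congrArg some (hW h)
    have h0 : ∀ i (o : Option κ), 1 - Y i * o.elim 0 W ≠ 0 := by
      rintro i (_ | a)
      · simp
      · exact h1 i a
    have lim := ((continuousAt_subsetSum q (fun _ => Y) (fun s (o : Option κ) => o.elim s W) v 0
      (fun i => continuousAt_const) hc hY h0).eventuallyEq_nhds_iff_eventuallyEq_nhdsNE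
      (continuousAt_const.mul (continuousAt_subsetSum q (fun s (o : Option κ) => o.elim s W)
        (fun _ => Y) v 0 hc (fun i => continuousAt_const) hinj
        (fun o i => by rw [mul_comm]; exact h0 i o)))).mp key
    have := lim.eq_of_nhds
    rw [Pi.mul_apply, subsetSum_option_zero_right, subsetSum_option_zero q W Y hW0] at this
    rw [this, Finset.prod_range_succ']
    simp only [add_zero, add_assoc, add_comm 1]
    ring

/-! ### Vandermonde products of shifted variables -/

open Finset in
/-- The factors of `vandermonde_shift_eq` that belong to a pair `i < j`, with `a = μ i` and
`b = μ j`. -/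
theorem pair_prod_eq (q x y : ℂ) (a b : ℕ) :
    q ^ (a * b) * (x - y) * ((∏ k ∈ range a, (q ^ (k + 1) * x - y))
        * ∏ k ∈ range b, (q ^ (k + 1) * y - x))
      = (q ^ a * x - q ^ b * y) * ((∏ k ∈ range a, (q ^ k * x - q ^ b * y))
        * ∏ k ∈ range b, (q ^ k * y - q ^ a * x)) := by
  induction b with
  | zero =>
    have h := Finset.prod_range_succ (fun k => q ^ k * x - y) a
    rw [Finset.prod_range_succ'] at h
    simp only [pow_zero, one_mul] at h
    simp only [mul_zero, pow_zero, Finset.prod_range_zero, mul_one, one_mul]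
    linear_combination h
  | succ b ih =>
    have h1 := Finset.prod_range_succ (fun k => q ^ k * x - q ^ (b + 1) * y) a
    rw [Finset.prod_range_succ'] at h1
    have h2 : ∏ k ∈ range a, (q ^ (k + 1) * x - q ^ (b + 1) * y)
        = q ^ a * ∏ k ∈ range a, (q ^ k * x - q ^ b * y) := by
      rw [Finset.prod_congr rfl fun k _ => (by ring : q ^ (k + 1) * x - q ^ (b + 1) * y
        = q * (q ^ k * x - q ^ b * y)),
        Finset.prod_mul_distrib, Finset.prod_const, Finset.card_range]
    rw [h2] at h1
    rw [Finset.prod_range_succ (fun k => q ^ (k + 1) * y - x),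
      Finset.prod_range_succ (fun k => q ^ k * y - q ^ a * x)]
    have h3 : q ^ (a * (b + 1)) = q ^ (a * b) * q ^ a := by rw [← pow_add]; ring
    rw [h3]
    linear_combination (q ^ a * (q ^ (b + 1) * y - x)) * ih
      + (∏ k ∈ range b, (q ^ k * y - q ^ a * x)) * (q ^ b * y - q ^ a * x) * h1

open Finset in
/-- The factors of `vandermonde_shift_eq` that belong to a diagonal pair `(i, i)`. -/
theorem diag_prod_eq (q x : ℂ) (a : ℕ) :
    (-1) ^ a * q ^ a.choose 2 * ∏ k ∈ range a, (q ^ (k + 1) * x - x)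
      = ∏ k ∈ range a, (q ^ k * x - q ^ a * x) := by
  induction a with
  | zero => simp
  | succ a ih =>
    rw [Finset.prod_range_succ (fun k => q ^ (k + 1) * x - x), Finset.prod_range_succ']
    have h2 : ∏ k ∈ range a, (q ^ (k + 1) * x - q ^ (a + 1) * x)
        = q ^ a * ∏ k ∈ range a, (q ^ k * x - q ^ a * x) := by
      rw [Finset.prod_congr rfl fun k _ => (by ring : q ^ (k + 1) * x - q ^ (a + 1) * x
        = q * (q ^ k * x - q ^ a * x)),
        Finset.prod_mul_distrib, Finset.prod_const, Finset.card_range]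
    rw [h2, Nat.choose_succ_succ' a 1, Nat.choose_one_right, pow_add]
    linear_combination (- q ^ a * (q ^ (a + 1) * x - x)) * ih

/-- The ratio of Vandermonde products `Δ(q ^ μ x) / Δ(x)`, cleared of denominators. -/
theorem vandermonde_shift_eq (q : ℂ) {n : ℕ} (x : Fin n → ℂ) (μ : Fin n → ℕ) :
    (-1) ^ (∑ i, μ i) * q ^ (∑ i, μ i).choose 2 * vandermondeProd x
        * ∏ i, ∏ j, ∏ k ∈ Finset.range (μ i), (q ^ (k + 1) * x i - x j)
      = vandermondeProd (fun i => q ^ μ i * x i)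
        * ∏ i, ∏ j, ∏ k ∈ Finset.range (μ i), (q ^ k * x i - q ^ μ j * x j) := by
  have h := choose_two_sum μ
  have h2 : q ^ (∑ i, μ i).choose 2 = (∏ i, q ^ (μ i).choose 2)
      * ∏ i, ∏ j ∈ Finset.Ioi i, q ^ (μ i * μ j) := by
    rw [h, pow_add, ← Finset.prod_pow_eq_pow_sum, ← Finset.prod_pow_eq_pow_sum]
    congr 1
    exact Finset.prod_congr rfl fun i _ => (Finset.prod_pow_eq_pow_sum _ _ _).symm
  rw [prod_prod_eq_prod_diag_mul_prod_Ioi, prod_prod_eq_prod_diag_mul_prod_Ioi, h2,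
    ← Finset.prod_pow_eq_pow_sum]
  unfold vandermondeProd
  have hd : ∏ i, ∏ k ∈ Finset.range (μ i), (q ^ k * x i - q ^ μ i * x i)
      = (∏ i, (-1) ^ μ i) * (∏ i, q ^ (μ i).choose 2)
        * ∏ i, ∏ k ∈ Finset.range (μ i), (q ^ (k + 1) * x i - x i) := by
    simp only [← Finset.prod_mul_distrib]
    exact Finset.prod_congr rfl fun i _ => (diag_prod_eq q (x i) (μ i)).symm
  have ho : (∏ i, ∏ j ∈ Finset.Ioi i, q ^ (μ i * μ j)) * (∏ i, ∏ j ∈ Finset.Ioi i, (x i - x j))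
      * ∏ i, ∏ j ∈ Finset.Ioi i, ((∏ k ∈ Finset.range (μ i), (q ^ (k + 1) * x i - x j))
          * ∏ k ∈ Finset.range (μ j), (q ^ (k + 1) * x j - x i))
      = (∏ i, ∏ j ∈ Finset.Ioi i, (q ^ μ i * x i - q ^ μ j * x j))
      * ∏ i, ∏ j ∈ Finset.Ioi i, ((∏ k ∈ Finset.range (μ i), (q ^ k * x i - q ^ μ j * x j))
          * ∏ k ∈ Finset.range (μ j), (q ^ k * x j - q ^ μ i * x i)) := by
    simp only [← Finset.prod_mul_distrib]
    refine Finset.prod_congr rfl fun i _ => Finset.prod_congr rfl fun j _ => ?_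
    have := pair_prod_eq q (x i) (x j) (μ i) (μ j)
    rw [this]
  rw [hd]
  linear_combination (∏ i, (-1) ^ μ i) * (∏ i, q ^ (μ i).choose 2)
        * (∏ i, ∏ k ∈ Finset.range (μ i), (q ^ (k + 1) * x i - x i)) * ho

/-! ### Fusion: nodes in geometric strings -/

/-- The nodes of the source sum: the `y j` and the geometric strings `x i, q x i, …` of length
`L`. -/
noncomputable def fuseNodes (q : ℂ) (L : ℕ) {n m : ℕ} (x : Fin n → ℂ) (y : Fin m → ℂ) :
    Fin m ⊕ Fin n × Fin L → ℂ :=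
  Sum.elim y fun p => q ^ (p.2 : ℕ) * x p.1

/-- The set of nodes with label `(μ, I)`: the `y j` with `j ∈ I`, and the first `μ i` members of
the string of `x i`. -/
def fuseSet (L : ℕ) {n m : ℕ} (p : (Fin n → ℕ) × Finset (Fin m)) :
    Finset (Fin m ⊕ Fin n × Fin L) :=
  p.2.disjSum (Finset.univ.filter fun s : Fin n × Fin L => (s.2 : ℕ) < p.1 s.1)

@[simp] theorem inl_mem_fuseSet {L n m : ℕ} (p : (Fin n → ℕ) × Finset (Fin m)) (j : Fin m) :
    Sum.inl j ∈ fuseSet L p ↔ j ∈ p.2 := by simp [fuseSet]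

@[simp] theorem inr_mem_fuseSet {L n m : ℕ} (p : (Fin n → ℕ) × Finset (Fin m)) (i : Fin n)
    (k : Fin L) : Sum.inr (i, k) ∈ fuseSet L p ↔ (k : ℕ) < p.1 i := by simp [fuseSet]

theorem prod_fin_lt {L a : ℕ} (h : a ≤ L) (g : ℕ → ℂ) :
    (∏ k : Fin L, if (k : ℕ) < a then g k else 1) = ∏ k ∈ Finset.range a, g k := by
  rw [Fin.prod_univ_eq_prod_range (fun k => if k < a then g k else 1) L, ← Finset.prod_filter]
  congr 1
  ext k; simp; omega

theorem card_fuseSet {L n m : ℕ} (p : (Fin n → ℕ) × Finset (Fin m)) (h : ∀ i, p.1 i ≤ L) :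
    (fuseSet L p).card = ∑ i, p.1 i + p.2.card := by
  rw [fuseSet, Finset.card_disjSum, add_comm]
  congr 1
  rw [Finset.card_filter, Fintype.sum_prod_type]
  refine Finset.sum_congr rfl fun i _ => ?_
  rw [Fin.sum_univ_eq_sum_range (fun k => if k < p.1 i then 1 else 0) L, ← Finset.card_filter]
  rw [← Finset.card_range (p.1 i)]
  congr 1
  have := h i
  ext k; simp; omega

/-- A telescoping product over the part of a string outside an initial segment. -/
theorem prod_fin_ge_div {L a : ℕ} (h : a ≤ L) (g : ℕ → ℂ) (hg : ∀ k, a ≤ k → k < L → g k ≠ 0) :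
    (∏ k : Fin L, if ¬ (k : ℕ) < a then g (k + 1) / g k else 1) * g a = g L := by
  rw [Fin.prod_univ_eq_prod_range (fun k => if ¬ k < a then g (k + 1) / g k else 1) L]
  induction L, h using Nat.le_induction with
  | base =>
    rw [Finset.prod_eq_one, one_mul]
    intro k hk
    rw [if_neg]
    simpa using hk
  | succ L hL ih =>
    rw [Finset.prod_range_succ, if_pos (by omega)]
    have h1 := ih fun k h1 h2 => hg k h1 (by omega)
    have := hg L hL (by omega)
    rw [mul_right_comm, h1, mul_div_cancel₀ _ this]

/-- A telescoping product over an initial segment of a string. -/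
theorem prod_fin_lt_div {L a : ℕ} (h : a ≤ L) (g : ℕ → ℂ) (hg : ∀ k, k ≤ a → g k ≠ 0) :
    (∏ k : Fin L, if (k : ℕ) < a then g (k + 1) / g k else 1) = g a / g 0 := by
  rw [prod_fin_lt h fun k => g (k + 1) / g k]
  clear h
  induction a with
  | zero => simp [hg 0 le_rfl]
  | succ a ih =>
    rw [Finset.prod_range_succ, ih fun k hk => hg k (by omega)]
    have := hg a (by omega)
    field_simp

theorem prod_ite_irrel_one {ι : Type*} (s : Finset ι) (c : Prop) [Decidable c] (g : ι → ℂ) :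
    (∏ i ∈ s, if c then g i else 1) = if c then ∏ i ∈ s, g i else 1 := by
  split_ifs <;> simp

theorem prod_ite_mem_univ {m : ℕ} (I : Finset (Fin m)) (g : Fin m → ℂ) :
    (∏ i, if i ∈ I then g i else 1) = ∏ i ∈ I, g i := by simp

theorem prod_ite_notMem_univ {m : ℕ} (I : Finset (Fin m)) (g : Fin m → ℂ) :
    (∏ i, if i ∉ I then g i else 1) = ∏ i ∈ Iᶜ, g i := by
  rw [← prod_ite_mem_univ Iᶜ]; simp only [Finset.mem_compl]

/-- None of the products `x i * z j`, `x i * w j`, `y i * w j`, `y i * z j` is of the form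
`q ^ (-k)` with `k : ℕ`; the source identity then applies to strings of any length. -/
def KernelGeneric (q : ℂ) {n m N M : ℕ} (x : Fin n → ℂ) (y : Fin m → ℂ)
    (z : Fin N → ℂ) (w : Fin M → ℂ) : Prop :=
  (∀ i j, ∀ k : ℕ, q ^ k * (x i * z j) ≠ 1) ∧ (∀ i j, ∀ k : ℕ, q ^ k * (x i * w j) ≠ 1) ∧
  (∀ i j, ∀ k : ℕ, q ^ k * (y i * w j) ≠ 1) ∧ (∀ i j, ∀ k : ℕ, q ^ k * (y i * z j) ≠ 1)

/-- The ratio of the kernel function with `x`, `y` shifted according to the label `(μ, I)` and the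
unshifted kernel function, see `kernelFun_shift`. -/
noncomputable def kernelRatio (q t : ℂ) {n m N M : ℕ} (x : Fin n → ℂ) (y : Fin m → ℂ)
    (z : Fin N → ℂ) (w : Fin M → ℂ) (p : (Fin n → ℕ) × Finset (Fin m)) : ℂ :=
  (∏ i, ∏ j, qPoch (t⁻¹ * x i * z j) q (p.1 i) / qPoch (x i * z j) q (p.1 i))
    * (∏ i ∈ p.2, ∏ j, (1 - q * y i * w j) / (1 - y i * w j))
    * (∏ i, ∏ j, (1 - q ^ p.1 i * x i * w j) / (1 - x i * w j))
    * ∏ i ∈ p.2, ∏ j, (1 - t⁻¹ * y i * z j) / (1 - y i * z j)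

/-- The coefficient of the shift operator with label `(μ, I)` in the deformed NS operators. -/
noncomputable def nsWeight (q t : ℂ) {n m : ℕ} (x : Fin n → ℂ) (y : Fin m → ℂ)
    (p : (Fin n → ℕ) × Finset (Fin m)) : ℂ :=
  (t ^ (1 - (n : ℤ)) * q ^ m) ^ (∑ i, p.1 i) * (-t) ^ p.2.card * q ^ p.2.card.choose 2
    * nsCoeff q t p.1 p.2 x y

/-- The factors of the source weight that involve both groups of nodes telescope along the
strings. -/
theorem fuse_kernel_prod (q : ℂ) (L : ℕ) {n m N M : ℕ} (x : Fin n → ℂ) (y : Fin m → ℂ)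
    (z : Fin N → ℂ) (w : Fin M → ℂ) (hg : KernelGeneric q x y z w)
    (p : (Fin n → ℕ) × Finset (Fin m)) (hp : ∀ i, p.1 i ≤ L) :
    (∏ a, ∏ k, if a ∈ fuseSet L p then (1 - q * fuseNodes q L x y a * fuseNodes q L z w k)
        / (1 - fuseNodes q L x y a * fuseNodes q L z w k) else 1)
      = kernelRatio q (q ^ L)⁻¹ x y z w p := by
  obtain ⟨g1, g2, g3, g4⟩ := hg
  have n1 : ∀ i j (k : ℕ), 1 - q ^ k * (x i * z j) ≠ 0 := fun i j k =>
    sub_ne_zero.mpr (g1 i j k).symm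
  have n2 : ∀ i j (k : ℕ), 1 - q ^ k * (x i * w j) ≠ 0 := fun i j k =>
    sub_ne_zero.mpr (g2 i j k).symm
  have n4 : ∀ i j (k : ℕ), 1 - q ^ k * (y i * z j) ≠ 0 := fun i j k =>
    sub_ne_zero.mpr (g4 i j k).symm
  simp only [Fintype.prod_sum_type, Fintype.prod_prod_type, Finset.prod_mul_distrib,
    inl_mem_fuseSet, inr_mem_fuseSet, fuseNodes, Sum.elim_inl, Sum.elim_inr]
  have k1 : (∏ i, ∏ j, if i ∈ p.2 then (1 - q * y i * w j) / (1 - y i * w j) else 1)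
      = ∏ i ∈ p.2, ∏ j, (1 - q * y i * w j) / (1 - y i * w j) := by
    simp only [prod_ite_irrel_one, prod_ite_mem_univ]
  have k2 : (∏ i, ∏ j, ∏ l : Fin L, if i ∈ p.2 then (1 - q * y i * (q ^ (l : ℕ) * z j))
        / (1 - y i * (q ^ (l : ℕ) * z j)) else 1)
      = ∏ i ∈ p.2, ∏ j, (1 - (q ^ L)⁻¹⁻¹ * y i * z j) / (1 - y i * z j) := by
    simp only [prod_ite_irrel_one, prod_ite_mem_univ]
    refine Finset.prod_congr rfl fun i _ => Finset.prod_congr rfl fun j _ => ?_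
    have := prod_fin_lt_div (le_refl L) (fun k => 1 - q ^ k * (y i * z j)) (fun k _ => n4 i j k)
    rw [inv_inv]
    simp only [Fin.is_lt, if_true, pow_zero, one_mul] at this
    rw [mul_assoc, ← this]
    exact Finset.prod_congr rfl fun k _ => by congr 1 <;> ring
  have k3 : (∏ i, ∏ k : Fin L, ∏ j, if (k : ℕ) < p.1 i then
        (1 - q * (q ^ (k : ℕ) * x i) * w j) / (1 - q ^ (k : ℕ) * x i * w j) else 1)
      = ∏ i, ∏ j, (1 - q ^ p.1 i * x i * w j) / (1 - x i * w j) := by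
    refine Finset.prod_congr rfl fun i _ => ?_
    rw [Finset.prod_comm]
    refine Finset.prod_congr rfl fun j _ => ?_
    have := prod_fin_lt_div (hp i) (fun k => 1 - q ^ k * (x i * w j)) (fun k _ => n2 i j k)
    simp only [pow_zero, one_mul] at this
    rw [mul_assoc, ← this]
    exact Finset.prod_congr rfl fun k _ => by split_ifs; congr 1 <;> ring; rfl
  have k4 : (∏ i, ∏ k : Fin L, ∏ j, ∏ l : Fin L, if (k : ℕ) < p.1 i then
        (1 - q * (q ^ (k : ℕ) * x i) * (q ^ (l : ℕ) * z j))
          / (1 - q ^ (k : ℕ) * x i * (q ^ (l : ℕ) * z j)) else 1)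
      = ∏ i, ∏ j, qPoch ((q ^ L)⁻¹⁻¹ * x i * z j) q (p.1 i) / qPoch (x i * z j) q (p.1 i) := by
    refine Finset.prod_congr rfl fun i _ => ?_
    rw [Finset.prod_comm]
    refine Finset.prod_congr rfl fun j _ => ?_
    simp only [prod_ite_irrel_one]
    unfold qPoch
    rw [← Finset.prod_div_distrib, ← prod_fin_lt (hp i)]
    refine Finset.prod_congr rfl fun k _ => ?_
    congr 1
    have := prod_fin_lt_div (le_refl L) (fun l => 1 - q ^ (k + l : ℕ) * (x i * z j))
      (fun l _ => n1 i j _)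
    simp only [Fin.is_lt, if_true, add_zero] at this
    rw [inv_inv, show (1 - q ^ L * x i * z j * q ^ (k : ℕ)) / (1 - x i * z j * q ^ (k : ℕ))
      = (1 - q ^ (k + L : ℕ) * (x i * z j)) / (1 - q ^ (k : ℕ) * (x i * z j)) by
        congr 1 <;> ring, ← this]
    exact Finset.prod_congr rfl fun l _ => by congr 1 <;> ring
  rw [k1, k2, k3, k4, kernelRatio]
  ring

theorem pow_mul_ne_pow_mul {q : ℂ} (hq0 : q ≠ 0) (hq : ∀ k : ℕ, q ^ (k + 1) ≠ 1) {x : ℂ}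
    (hx : x ≠ 0) {k l : ℕ} (hkl : k < l) : q ^ k * x ≠ q ^ l * x := by
  intro h
  obtain ⟨d, hd⟩ := Nat.exists_eq_add_of_lt hkl
  have h' := mul_right_cancel₀ hx h
  rw [hd, add_assoc, pow_add] at h'
  exact hq d (mul_left_cancel₀ (pow_ne_zero k hq0) (by rw [← h', mul_one]))

theorem pow_mul_ne_pow_mul' {q : ℂ} (hq0 : q ≠ 0) {n : ℕ} {x : Fin n → ℂ}
    (hxx : ∀ i j, i ≠ j → ∀ k : ℕ, q ^ k * x i ≠ x j) {i j : Fin n} (hij : i ≠ j) (k l : ℕ) :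
    q ^ k * x i ≠ q ^ l * x j := by
  intro h
  rcases le_total k l with hkl | hkl
  · obtain ⟨d, rfl⟩ := Nat.exists_eq_add_of_le hkl
    rw [pow_add, mul_assoc] at h
    exact hxx j i hij.symm d (mul_left_cancel₀ (pow_ne_zero _ hq0) h).symm
  · obtain ⟨d, rfl⟩ := Nat.exists_eq_add_of_le hkl
    rw [pow_add, mul_assoc] at h
    exact hxx i j hij d (mul_left_cancel₀ (pow_ne_zero _ hq0) h)

/-- The contribution of the strings to the products over pairs of nodes, in terms of the Vandermonde
ratio and the `q`-Pochhammer symbols of the deformed NS coefficients with `t = q ^ (-L)`. -/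
theorem string_prod_eq (q t : ℂ) (ht : t ≠ 0) {n : ℕ} (x : Fin n → ℂ)
    (hx0 : ∀ i, x i ≠ 0) (hxx : ∀ i j, i ≠ j → ∀ k : ℕ, q ^ k * x i ≠ x j)
    (hq0 : q ≠ 0) (hq : ∀ k : ℕ, q ^ (k + 1) ≠ 1) (μ : Fin n → ℕ) :
    (-1) ^ (∑ i, μ i) * q ^ (∑ i, μ i).choose 2
        * ∏ i, ∏ j, ∏ k ∈ Finset.range (μ i), (q ^ k * x i - t⁻¹ * x j)
          / (q ^ k * x i - q ^ μ j * x j)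
      = ((t⁻¹) ^ n) ^ (∑ i, μ i) * (vandermondeProd (fun i => q ^ μ i * x i) / vandermondeProd x
          * ∏ i, ∏ j, qPoch (t * x i / x j) q (μ i) / qPoch (q * x i / x j) q (μ i)) := by
  have hD : ∏ i, ∏ j, ∏ k ∈ Finset.range (μ i), (q ^ k * x i - q ^ μ j * x j) ≠ 0 := by
    refine Finset.prod_ne_zero_iff.mpr fun i _ => Finset.prod_ne_zero_iff.mpr fun j _ =>
      Finset.prod_ne_zero_iff.mpr fun k hk => sub_ne_zero.mpr ?_
    by_cases hij : i = j
    · subst hij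
      exact pow_mul_ne_pow_mul hq0 hq (hx0 i) (Finset.mem_range.mp hk)
    · exact pow_mul_ne_pow_mul' hq0 hxx hij k _
  have hV : vandermondeProd x ≠ 0 := by
    refine Finset.prod_ne_zero_iff.mpr fun i _ => Finset.prod_ne_zero_iff.mpr fun j hj =>
      sub_ne_zero.mpr ?_
    simpa using hxx i j (Finset.mem_Ioi.mp hj).ne 0
  -- `(a x_i / x_j; q)_k` is, up to a power of `-x_j`, a product of differences
  have hpoch : ∀ (a : ℂ) i j (k : ℕ), (-x j) ^ k * qPoch (a * x i / x j) q k
      = ∏ l ∈ Finset.range k, (a * q ^ l * x i - x j) := by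
    intro a i j k
    rw [qPoch, ← Finset.card_range k, ← Finset.prod_const, Finset.card_range,
      ← Finset.prod_mul_distrib]
    refine Finset.prod_congr rfl fun l _ => ?_
    have := hx0 j
    field_simp
    ring
  have hQ : ∏ i, ∏ j, qPoch (q * x i / x j) q (μ i) ≠ 0 := by
    refine Finset.prod_ne_zero_iff.mpr fun i _ => Finset.prod_ne_zero_iff.mpr fun j _ =>
      Finset.prod_ne_zero_iff.mpr fun k _ => ?_
    intro h
    have h0 := hx0 j
    have h' : q ^ (k + 1) * x i = x j := by
      field_simp at h
      linear_combination -h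
    by_cases hij : i = j
    · subst hij
      exact hq k (mul_right_cancel₀ h0 (by rw [h', one_mul]))
    · exact hxx i j hij _ h'
  have hX : ∏ i, ∏ j, (-x j) ^ μ i ≠ 0 :=
    Finset.prod_ne_zero_iff.mpr fun i _ => Finset.prod_ne_zero_iff.mpr fun j _ =>
      pow_ne_zero _ (neg_ne_zero.mpr (hx0 j))
  have hN : ∏ i, ∏ j, ∏ k ∈ Finset.range (μ i), (q ^ k * x i - t⁻¹ * x j)
      = ((t⁻¹) ^ n) ^ (∑ i, μ i) * ((∏ i, ∏ j, (-x j) ^ μ i)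
        * ∏ i, ∏ j, qPoch (t * x i / x j) q (μ i)) := by
    rw [← pow_mul, Finset.mul_sum, ← Finset.prod_pow_eq_pow_sum]
    simp only [← Finset.prod_mul_distrib]
    refine Finset.prod_congr rfl fun i _ => ?_
    have : (t⁻¹) ^ (n * μ i) = ∏ _j : Fin n, (t⁻¹) ^ μ i := by
      rw [Finset.prod_const, Finset.card_univ, Fintype.card_fin, ← pow_mul, mul_comm]
    rw [this, ← Finset.prod_mul_distrib]
    refine Finset.prod_congr rfl fun j _ => ?_
    rw [hpoch, ← Finset.card_range (μ i), ← Finset.prod_const, Finset.card_range,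
      ← Finset.prod_mul_distrib]
    refine Finset.prod_congr rfl fun k _ => ?_
    field_simp
  have hA : ∏ i, ∏ j, ∏ k ∈ Finset.range (μ i), (q ^ (k + 1) * x i - x j)
      = (∏ i, ∏ j, (-x j) ^ μ i) * ∏ i, ∏ j, qPoch (q * x i / x j) q (μ i) := by
    simp only [← Finset.prod_mul_distrib, hpoch]
    refine Finset.prod_congr rfl fun i _ => Finset.prod_congr rfl fun j _ =>
      Finset.prod_congr rfl fun k _ => ?_
    ring
  have key := vandermonde_shift_eq q x μ
  rw [hA] at key
  simp only [Finset.prod_div_distrib]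
  rw [hN]
  field_simp
  linear_combination (∏ i, ∏ j, qPoch (t * x i / x j) q (μ i)) * key

/-- The factors of the source weight that belong to pairs of nodes of the same group, telescoped
along the strings. -/
theorem fuse_pair_prod (q : ℂ) (L : ℕ) {n m : ℕ} (x : Fin n → ℂ) (y : Fin m → ℂ)
    (hq0 : q ≠ 0) (hq : ∀ k : ℕ, q ^ (k + 1) ≠ 1) (hr : NSRegular q x y)
    (p : (Fin n → ℕ) × Finset (Fin m)) (hp : ∀ i, p.1 i ≤ L) :
    (∏ a, ∏ b, if a ∈ fuseSet L p ∧ b ∉ fuseSet L p then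
        (fuseNodes q L x y a - q * fuseNodes q L x y b)
          / (fuseNodes q L x y a - fuseNodes q L x y b) else 1)
      = (∏ i ∈ p.2, ∏ j ∈ p.2ᶜ, (y i - q * y j) / (y i - y j))
        * (∏ i, ∏ j ∈ p.2, (1 - x i / ((q ^ L)⁻¹ * y j)) / (1 - q ^ p.1 i * x i / y j))
        * (∏ i, ∏ j ∈ p.2ᶜ, q ^ p.1 i * ((1 - x i / (q * y j))
            / (1 - q ^ ((p.1 i : ℤ) - 1) * x i / y j)))
        * ∏ i, ∏ j, ∏ k ∈ Finset.range (p.1 i), (q ^ k * x i - (q ^ L)⁻¹⁻¹ * x j)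
          / (q ^ k * x i - q ^ p.1 j * x j) := by
  obtain ⟨hx0, hy0, hxx, hyy, hxy⟩ := hr
  have hxy' : ∀ i j (k : ℕ), y j ≠ q ^ k * x i := fun i j k h =>
    hxy i j (k + 1) (by rw [h]; ring)
  simp only [Fintype.prod_sum_type, Fintype.prod_prod_type, Finset.prod_mul_distrib,
    inl_mem_fuseSet, inr_mem_fuseSet, fuseNodes, Sum.elim_inl, Sum.elim_inr, ite_and]
  have k1 : (∏ i, ∏ j, if i ∈ p.2 then if j ∉ p.2 then (y i - q * y j) / (y i - y j) else 1 else 1)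
      = ∏ i ∈ p.2, ∏ j ∈ p.2ᶜ, (y i - q * y j) / (y i - y j) := by
    simp only [prod_ite_irrel_one, prod_ite_mem_univ, prod_ite_notMem_univ]
  have k2 : (∏ i, ∏ j, ∏ l : Fin L, if i ∈ p.2 then if ¬ (l : ℕ) < p.1 j then
        (y i - q * (q ^ (l : ℕ) * x j)) / (y i - q ^ (l : ℕ) * x j) else 1 else 1)
      = ∏ i, ∏ j ∈ p.2, (1 - x i / ((q ^ L)⁻¹ * y j)) / (1 - q ^ p.1 i * x i / y j) := by
    simp only [prod_ite_irrel_one, prod_ite_mem_univ]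
    rw [Finset.prod_comm]
    refine Finset.prod_congr rfl fun i _ => Finset.prod_congr rfl fun j _ => ?_
    have h := prod_fin_ge_div (hp i) (fun k => y j - q ^ k * x i)
      (fun k _ _ => sub_ne_zero.mpr (hxy' i j k))
    have h0 := hy0 j
    have h1 : y j - q ^ p.1 i * x i ≠ 0 := sub_ne_zero.mpr (hxy' i j _)
    have h2 : 1 - q ^ p.1 i * x i / y j ≠ 0 := by
      intro h; apply h1; field_simp at h; linear_combination h
    rw [show (1 - x i / ((q ^ L)⁻¹ * y j)) / (1 - q ^ p.1 i * x i / y j)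
      = (y j - q ^ L * x i) / (y j - q ^ p.1 i * x i) by
        rw [div_eq_div_iff h2 h1]; field_simp, eq_div_iff h1, ← h]
    congr 1
    refine Finset.prod_congr rfl fun k _ => ?_
    rw [← mul_assoc, ← pow_succ']
  have k3 : (∏ i, ∏ k : Fin L, ∏ j, if (k : ℕ) < p.1 i then if j ∉ p.2 then
        (q ^ (k : ℕ) * x i - q * y j) / (q ^ (k : ℕ) * x i - y j) else 1 else 1)
      = ∏ i, ∏ j ∈ p.2ᶜ, q ^ p.1 i * ((1 - x i / (q * y j))
            / (1 - q ^ ((p.1 i : ℤ) - 1) * x i / y j)) := by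
    refine Finset.prod_congr rfl fun i _ => ?_
    simp only [prod_ite_irrel_one, prod_ite_notMem_univ]
    rw [prod_fin_lt (hp i) (fun k => ∏ j ∈ p.2ᶜ, (q ^ k * x i - q * y j) / (q ^ k * x i - y j)),
      Finset.prod_comm]
    refine Finset.prod_congr rfl fun j _ => ?_
    -- the factors telescope when written with `q ^ k / (q ^ k x_i - q y_j)`
    have hne : ∀ k : ℕ, q ^ k * x i - q * y j ≠ 0 := fun k => sub_ne_zero.mpr (hxy i j k)
    have h := prod_fin_lt_div (hp i) (fun k => q ^ k / (q ^ k * x i - q * y j))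
      (fun k _ => div_ne_zero (pow_ne_zero _ hq0) (hne k))
    rw [prod_fin_lt (hp i) (fun k => q ^ (k + 1) / (q ^ (k + 1) * x i - q * y j)
      / (q ^ k / (q ^ k * x i - q * y j)))] at h
    have e : q ^ ((p.1 i : ℤ) - 1) = q ^ p.1 i / q := by
      rw [zpow_sub₀ hq0, zpow_natCast, zpow_one]
    have h0 := hy0 j
    have h1 := hne (p.1 i)
    have h2 : x i - q * y j ≠ 0 := by simpa using hne 0
    have ea : 1 - x i / (q * y j) = (x i - q * y j) / -(q * y j) := by field_simp; ring
    have eb : 1 - q ^ p.1 i / q * x i / y j = (q ^ p.1 i * x i - q * y j) / -(q * y j) := by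
      field_simp; ring
    have hqy : -(q * y j) ≠ 0 := neg_ne_zero.mpr (mul_ne_zero hq0 h0)
    rw [e, ea, eb, div_div_div_cancel_right₀ hqy,
      show q ^ p.1 i * ((x i - q * y j) / (q ^ p.1 i * x i - q * y j))
      = q ^ p.1 i / (q ^ p.1 i * x i - q * y j) / (q ^ 0 / (q ^ 0 * x i - q * y j)) by
        rw [pow_zero, one_mul, div_div_eq_mul_div, div_one, div_mul_eq_mul_div, ← mul_div_assoc],
      ← h]
    refine Finset.prod_congr rfl fun k _ => ?_
    have h4 := hne k
    have h5 := hne (k + 1)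
    have h6 : q ^ k * x i - y j ≠ 0 := sub_ne_zero.mpr (hxy' i j k).symm
    rw [div_div_eq_mul_div, div_mul_eq_mul_div, div_div, div_eq_div_iff h6
      (mul_ne_zero h5 (pow_ne_zero _ hq0))]
    ring
  have k4 : (∏ i, ∏ k : Fin L, ∏ j, ∏ l : Fin L, if (k : ℕ) < p.1 i then
        if ¬ (l : ℕ) < p.1 j then (q ^ (k : ℕ) * x i - q * (q ^ (l : ℕ) * x j))
          / (q ^ (k : ℕ) * x i - q ^ (l : ℕ) * x j) else 1 else 1)
      = ∏ i, ∏ j, ∏ k ∈ Finset.range (p.1 i), (q ^ k * x i - (q ^ L)⁻¹⁻¹ * x j)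
          / (q ^ k * x i - q ^ p.1 j * x j) := by
    refine Finset.prod_congr rfl fun i _ => ?_
    rw [Finset.prod_comm]
    refine Finset.prod_congr rfl fun j _ => ?_
    simp only [prod_ite_irrel_one]
    rw [← prod_fin_lt (hp i)]
    refine Finset.prod_congr rfl fun k _ => ?_
    by_cases hk : (k : ℕ) < p.1 i
    · rw [if_pos hk, if_pos hk, inv_inv]
      have hne : ∀ l, p.1 j ≤ l → q ^ (k : ℕ) * x i - q ^ l * x j ≠ 0 := by
        intro l hl
        rw [sub_ne_zero]
        by_cases hij : i = j
        · subst hij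
          exact pow_mul_ne_pow_mul hq0 hq (hx0 i) (hk.trans_le hl)
        · exact pow_mul_ne_pow_mul' hq0 hxx hij _ _
      rw [eq_div_iff (hne _ le_rfl), ← prod_fin_ge_div (hp j)
        (fun l => q ^ (k : ℕ) * x i - q ^ l * x j) (fun l hl _ => hne l hl)]
      congr 1
      exact Finset.prod_congr rfl fun l _ => by rw [← mul_assoc q, ← pow_succ']
    · rw [if_neg hk, if_neg hk]
  rw [k1, k2, k3, k4]
  simp only [Finset.prod_mul_distrib]
  ring

theorem choose_two_add (a : ℕ) {b m : ℕ} (h : b ≤ m) :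
    (a + b).choose 2 + (m - b) * a = a.choose 2 + b.choose 2 + m * a := by
  obtain ⟨d, rfl⟩ := Nat.exists_eq_add_of_le h
  rw [Nat.add_choose_eq, Nat.add_sub_cancel_left]
  have : (Finset.HasAntidiagonal.antidiagonal 2 : Finset (ℕ × ℕ)) = {(0, 2), (1, 1), (2, 0)} := rfl
  rw [this]
  simp
  ring

/-- The source weight of a set of nodes made of initial segments of the strings is the coefficient
of the deformed NS operator times the ratio of kernel functions, for `t = q ^ (-L)`. -/
theorem subsetWeight_fuse (q t : ℂ) (L : ℕ) (ht : t = (q ^ L)⁻¹) {n m N M : ℕ} (x : Fin n → ℂ)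
    (y : Fin m → ℂ) (z : Fin N → ℂ) (w : Fin M → ℂ)
    (hq0 : q ≠ 0) (hq : ∀ k : ℕ, q ^ (k + 1) ≠ 1) (hr : NSRegular q x y)
    (hg : KernelGeneric q x y z w)
    (p : (Fin n → ℕ) × Finset (Fin m)) (hp : ∀ i, p.1 i ≤ L) :
    (-t) ^ (fuseSet L p).card * subsetWeight q (fuseNodes q L x y) (fuseNodes q L z w) (fuseSet L p)
      = nsWeight q t x y p * kernelRatio q t x y z w p := by
  have ht0 : t ≠ 0 := by rw [ht]; exact inv_ne_zero (pow_ne_zero _ hq0)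
  rw [subsetWeight, fuse_kernel_prod q L x y z w hg p hp, fuse_pair_prod q L x y hq0 hq hr p hp,
    ← ht, card_fuseSet p hp, nsWeight, nsCoeff]
  have hs := string_prod_eq q t ht0 x hr.1 hr.2.2.1 hq0 hq p.1
  have hc : (∏ i, ∏ j ∈ p.2ᶜ, q ^ p.1 i * ((1 - x i / (q * y j))
            / (1 - q ^ ((p.1 i : ℤ) - 1) * x i / y j)))
      = (q ^ (m - p.2.card)) ^ (∑ i, p.1 i) * ∏ i, ∏ j ∈ p.2ᶜ, (1 - x i / (q * y j))
            / (1 - q ^ ((p.1 i : ℤ) - 1) * x i / y j) := by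
    simp only [Finset.prod_mul_distrib, Finset.prod_const, Finset.card_compl, Fintype.card_fin]
    congr 1
    rw [← Finset.prod_pow_eq_pow_sum]
    exact Finset.prod_congr rfl fun i _ => by rw [← pow_mul, ← pow_mul, mul_comm]
  have hb : (∑ i, p.1 i + p.2.card).choose 2 + (m - p.2.card) * (∑ i, p.1 i)
      = (∑ i, p.1 i).choose 2 + p.2.card.choose 2 + m * (∑ i, p.1 i) := by
    exact choose_two_add _ (by simpa using Finset.card_le_univ p.2)
  have hb' : q ^ (∑ i, p.1 i + p.2.card).choose 2 * (q ^ (m - p.2.card)) ^ (∑ i, p.1 i)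
      = q ^ (∑ i, p.1 i).choose 2 * q ^ p.2.card.choose 2 * (q ^ m) ^ (∑ i, p.1 i) := by
    rw [← pow_mul, ← pow_mul, ← pow_add, ← pow_add, ← pow_add, hb]
  have htn : t ^ (1 - (n : ℤ)) = t * (t⁻¹) ^ n := by
    rw [zpow_sub₀ ht0, zpow_one, zpow_natCast, inv_pow, div_eq_mul_inv]
  rw [hc, htn, Finset.prod_mul_distrib, pow_add (-t), neg_pow t (∑ i, p.1 i), mul_pow, mul_pow]
  linear_combination (t ^ (∑ i, p.1 i) * (-t) ^ p.2.card
    * (∏ i ∈ p.2, ∏ j ∈ p.2ᶜ, (y i - q * y j) / (y i - y j))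
    * (∏ i, ∏ j ∈ p.2, (1 - x i / (t * y j)) / (1 - q ^ p.1 i * x i / y j))
    * (∏ i, ∏ j ∈ p.2ᶜ, (1 - x i / (q * y j)) / (1 - q ^ ((p.1 i : ℤ) - 1) * x i / y j))
    * kernelRatio q t x y z w p) * ((-1) ^ (∑ i, p.1 i)
    * (∏ i, ∏ j, ∏ k ∈ Finset.range (p.1 i), (q ^ k * x i - t⁻¹ * x j)
          / (q ^ k * x i - q ^ p.1 j * x j)) * hb' + q ^ p.2.card.choose 2
    * (q ^ m) ^ (∑ i, p.1 i) * hs)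

/-- The labels `(μ, I)` of total degree `r`. -/
def nsIndex (n m r : ℕ) : Finset ((Fin n → ℕ) × Finset (Fin m)) :=
  (Finset.HasAntidiagonal.antidiagonal r).biUnion fun d =>
    Finset.piAntidiag Finset.univ d.1 ×ˢ Finset.powersetCard d.2 Finset.univ

theorem mem_nsIndex {n m r : ℕ} (p : (Fin n → ℕ) × Finset (Fin m)) :
    p ∈ nsIndex n m r ↔ ∑ i, p.1 i + p.2.card = r := by
  simp [nsIndex]

theorem sum_nsIndex {n m r : ℕ} (g : (Fin n → ℕ) × Finset (Fin m) → ℂ) :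
    ∑ p ∈ nsIndex n m r, g p = ∑ d ∈ Finset.HasAntidiagonal.antidiagonal r,
      ∑ μ ∈ Finset.piAntidiag (Finset.univ : Finset (Fin n)) d.1,
      ∑ I ∈ Finset.powersetCard d.2 (Finset.univ : Finset (Fin m)), g (μ, I) := by
  rw [nsIndex, Finset.sum_biUnion]
  · exact Finset.sum_congr rfl fun d _ => Finset.sum_product _ _ _
  · intro d _ d' _ hne
    rw [Function.onFun, Finset.disjoint_left]
    intro p hp hp'
    apply hne
    simp only [Finset.mem_product, Finset.mem_piAntidiag, Finset.mem_powersetCard] at hp hp'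
    exact Prod.ext (hp.1.1.symm.trans hp'.1.1) (hp.2.2.symm.trans hp'.2.2)

/-- Sets of nodes of non-zero weight meet each string in an initial segment: if `a` is the successor
of `b` in a string, the factor `Y a - q Y b` vanishes. -/
theorem exists_fuseSet_eq (q : ℂ) (L : ℕ) {n m N M : ℕ} (x : Fin n → ℂ) (y : Fin m → ℂ)
    (z : Fin N → ℂ) (w : Fin M → ℂ) (J : Finset (Fin m ⊕ Fin n × Fin L))
    (hJ : subsetWeight q (fuseNodes q L x y) (fuseNodes q L z w) J ≠ 0) :
    ∃ p : (Fin n → ℕ) × Finset (Fin m), (∀ i, p.1 i ≤ L) ∧ fuseSet L p = J := by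
  have hdown : ∀ i (k : ℕ) (hk : k + 1 < L), Sum.inr (i, ⟨k + 1, hk⟩) ∈ J →
      Sum.inr (i, (⟨k, by omega⟩ : Fin L)) ∈ J := by
    intro i k hk h1
    by_contra h2
    apply hJ
    rw [subsetWeight, mul_eq_zero, mul_eq_zero]
    refine Or.inl (Or.inr (Finset.prod_eq_zero (Finset.mem_univ (Sum.inr (i, ⟨k + 1, hk⟩)))
      (Finset.prod_eq_zero (Finset.mem_univ (Sum.inr (i, ⟨k, by omega⟩))) ?_)))
    rw [if_pos ⟨h1, h2⟩]
    simp only [fuseNodes, Sum.elim_inr, ← mul_assoc, ← pow_succ', sub_self, zero_div]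
  have hμ : ∀ i, ∃ a ≤ L, ∀ k : Fin L, Sum.inr (i, k) ∈ J ↔ (k : ℕ) < a := by
    intro i
    classical
    have hex : ∃ a, ∀ h : a < L, Sum.inr (i, (⟨a, h⟩ : Fin L)) ∉ J := ⟨L, fun h => by omega⟩
    refine ⟨Nat.find hex, Nat.find_min' hex fun h => by omega, fun k => ⟨fun h => ?_, fun h => ?_⟩⟩
    · by_contra hle
      have hd : ∀ d (h : Nat.find hex + d < L),
          Sum.inr (i, (⟨Nat.find hex + d, h⟩ : Fin L)) ∉ J := by
        intro d
        induction d with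
        | zero => exact Nat.find_spec hex
        | succ d ih => exact fun h h' => ih (by omega) (hdown i _ h h')
      obtain ⟨d, hd'⟩ := Nat.exists_eq_add_of_le (not_lt.mp hle)
      refine hd d (by omega) ?_
      convert h
      exact hd'.symm
    · have := Nat.find_min hex h
      push Not at this
      exact this.2
  choose μ hμL hμ using hμ
  refine ⟨(μ, Finset.univ.filter fun j => Sum.inl j ∈ J), hμL, ?_⟩
  ext (j | ⟨i, k⟩)
  · simp
  · simp [hμ]

/-- For `t = q ^ (-L)` the homogeneous parts of the source sum are those of the deformed NS series:
labels with some `μ i > L` do not contribute, as `(t;q)_{μ i} = 0`. -/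
theorem sum_subsetWeight_fuse (q t : ℂ) (L : ℕ) (ht : t = (q ^ L)⁻¹) {n m N M : ℕ} (x : Fin n → ℂ)
    (y : Fin m → ℂ) (z : Fin N → ℂ) (w : Fin M → ℂ)
    (hq0 : q ≠ 0) (hq : ∀ k : ℕ, q ^ (k + 1) ≠ 1) (hr : NSRegular q x y)
    (hg : KernelGeneric q x y z w) (r : ℕ) :
    ∑ J ∈ Finset.powersetCard r Finset.univ,
        (-t) ^ J.card * subsetWeight q (fuseNodes q L x y) (fuseNodes q L z w) J
      = ∑ p ∈ nsIndex n m r, nsWeight q t x y p * kernelRatio q t x y z w p := by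
  have hvan : ∀ p ∈ nsIndex n m r, nsWeight q t x y p * kernelRatio q t x y z w p ≠ 0 →
      ∀ i, p.1 i ≤ L := by
    intro p _ hp i
    by_contra hlt
    apply hp
    rw [nsWeight, nsCoeff]
    have : ∏ i, ∏ j, qPoch (t * x i / x j) q (p.1 i) / qPoch (q * x i / x j) q (p.1 i) = 0 := by
      refine Finset.prod_eq_zero (Finset.mem_univ i) (Finset.prod_eq_zero (Finset.mem_univ i) ?_)
      have : qPoch (t * x i / x i) q (p.1 i) = 0 := by
        refine Finset.prod_eq_zero (Finset.mem_range.mpr (not_le.mp hlt)) ?_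
        rw [mul_div_assoc, div_self (hr.1 i), mul_one, ht, inv_mul_cancel₀ (pow_ne_zero _ hq0),
          sub_self]
      rw [this, zero_div]
    rw [this]
    ring
  rw [← Finset.sum_filter_of_ne hvan]
  symm
  refine Finset.sum_of_injOn (fuseSet L) ?_ ?_ ?_ ?_
  · intro p hp p' hp' h
    have hp := (Finset.mem_filter.mp hp).2
    have hp' := (Finset.mem_filter.mp hp').2
    refine Prod.ext (funext fun i => ?_) (Finset.ext fun j => ?_)
    · have key : ∀ k : Fin L, (k : ℕ) < p.1 i ↔ (k : ℕ) < p'.1 i := fun k => by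
        rw [← inr_mem_fuseSet, h, inr_mem_fuseSet]
      have h1 := hp i
      have h2 := hp' i
      rcases lt_trichotomy (p.1 i) (p'.1 i) with h3 | h3 | h3
      · exact absurd ((key ⟨p.1 i, by omega⟩).mpr h3) (lt_irrefl _)
      · exact h3
      · exact absurd ((key ⟨p'.1 i, by omega⟩).mp h3) (lt_irrefl _)
    · rw [← inl_mem_fuseSet (L := L), h, inl_mem_fuseSet]
  · intro p hp
    have hp := Finset.mem_filter.mp hp
    refine Finset.mem_coe.mpr (Finset.mem_powersetCard.mpr ⟨Finset.subset_univ _, ?_⟩)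
    rw [card_fuseSet p hp.2]
    exact (mem_nsIndex p).mp hp.1
  · intro J hJ hJ'
    by_contra hne
    obtain ⟨p, hp, rfl⟩ := exists_fuseSet_eq q L x y z w J (right_ne_zero_of_mul hne)
    refine hJ' ⟨p, ?_, rfl⟩
    rw [Finset.mem_coe, Finset.mem_filter, mem_nsIndex]
    rw [Finset.mem_powersetCard, card_fuseSet p hp] at hJ
    exact ⟨hJ.2, hp⟩
  · intro p hp
    exact (subsetWeight_fuse q t L ht x y z w hq0 hq hr hg p (Finset.mem_filter.mp hp).2).symm

/-! ### The formal identity for `t = q ^ (-L)` -/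

/-- The source sum with `v = t u`, as a formal power series in `u`. -/
noncomputable def subsetSeries (q t : ℂ) {ι κ : Type*} [Fintype ι] [DecidableEq ι] [Fintype κ]
    (Y : ι → ℂ) (W : κ → ℂ) : PowerSeries ℂ :=
  PowerSeries.mk fun r => ∑ J ∈ Finset.powersetCard r Finset.univ,
    (-t) ^ J.card * subsetWeight q Y W J

theorem hasValue_subsetSeries (q t : ℂ) {ι κ : Type*} [Fintype ι] [DecidableEq ι] [Fintype κ]
    (Y : ι → ℂ) (W : κ → ℂ) (u : ℂ) :
    (subsetSeries q t Y W).HasValue u (subsetSum q Y W (t * u)) := by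
  unfold PowerSeries.HasValue
  have : subsetSum q Y W (t * u) = ∑ r ∈ Finset.range (Fintype.card ι + 1),
      PowerSeries.coeff r (subsetSeries q t Y W) * u ^ r := by
    rw [subsetSum, ← Finset.powerset_univ, Finset.sum_powerset, Finset.card_univ]
    refine Finset.sum_congr rfl fun r _ => ?_
    rw [subsetSeries, PowerSeries.coeff_mk, Finset.sum_mul]
    refine Finset.sum_congr rfl fun J hJ => ?_
    rw [(Finset.mem_powersetCard.mp hJ).2, ← neg_mul, mul_pow]
    ring
  rw [this]
  refine hasSum_sum_of_ne_finset_zero fun r hr => ?_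
  rw [subsetSeries, PowerSeries.coeff_mk, Finset.powersetCard_eq_empty.mpr, Finset.sum_empty,
    zero_mul]
  rw [Finset.mem_range, not_lt] at hr
  rw [Finset.card_univ]
  omega

theorem qPochSeries_mul_subsetSeries_of_le {q : ℂ} (hq0 : q ≠ 0) (hq : ‖q‖ < 1) (t : ℂ)
    {ι κ : Type*} [Fintype ι] [DecidableEq ι] [Fintype κ] [DecidableEq κ]
    (h : Fintype.card κ ≤ Fintype.card ι)
    (Y : ι → ℂ) (W : κ → ℂ) (hY : Function.Injective Y)
    (hW : Function.Injective W) (hY0 : ∀ k, Y k ≠ 0) (hW0 : ∀ k, W k ≠ 0)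
    (h1 : ∀ i k, 1 - Y i * W k ≠ 0) (h2 : ∀ i k, 1 - q * Y i * W k ≠ 0) :
    qPochSeries (t * q ^ Fintype.card ι) q * subsetSeries q t Y W
      = qPochSeries (t * q ^ Fintype.card κ) q * subsetSeries q t W Y := by
  refine PowerSeries.eq_of_hasValue (fun u => (hasValue_qPochSeries hq _ u).mul
    (hasValue_subsetSeries q t Y W u)) fun u => ?_
  have := (hasValue_qPochSeries hq (t * q ^ Fintype.card κ) u).mul
    (hasValue_subsetSeries q t W Y u)
  convert this using 1
  obtain ⟨d, hd⟩ := Nat.exists_eq_add_of_le h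
  rw [subsetSum_eq_prod_mul q hq0 d hd Y W hY hW hY0 hW0 h1 h2,
    qPochInf_eq_qPoch_mul hq (t * q ^ Fintype.card κ * u) d, hd]
  have e1 : t * q ^ (Fintype.card κ + d) * u = q ^ d * (t * q ^ Fintype.card κ * u) := by
    rw [pow_add]; ring
  have e2 : ∏ k ∈ Finset.range d, (1 - t * u * q ^ (Fintype.card κ + k))
      = qPoch (t * q ^ Fintype.card κ * u) q d := by
    refine Finset.prod_congr rfl fun k _ => ?_
    rw [pow_add]; ring
  rw [e1, e2]
  ring

/-- The source identity in symmetric form, completed by infinite `q`-Pochhammer symbols. -/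
theorem qPochSeries_mul_subsetSeries {q : ℂ} (hq0 : q ≠ 0) (hq : ‖q‖ < 1) (t : ℂ)
    {ι κ : Type*} [Fintype ι] [DecidableEq ι] [Fintype κ] [DecidableEq κ]
    (Y : ι → ℂ) (W : κ → ℂ) (hY : Function.Injective Y)
    (hW : Function.Injective W) (hY0 : ∀ k, Y k ≠ 0) (hW0 : ∀ k, W k ≠ 0)
    (h1 : ∀ i k, 1 - Y i * W k ≠ 0) (h2 : ∀ i k, 1 - q * Y i * W k ≠ 0) :
    qPochSeries (t * q ^ Fintype.card ι) q * subsetSeries q t Y W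
      = qPochSeries (t * q ^ Fintype.card κ) q * subsetSeries q t W Y := by
  rcases le_total (Fintype.card κ) (Fintype.card ι) with h | h
  · exact qPochSeries_mul_subsetSeries_of_le hq0 hq t h Y W hY hW hY0 hW0 h1 h2
  · refine (qPochSeries_mul_subsetSeries_of_le hq0 hq t h W Y hW hY hW0 hY0
      (fun i k => ?_) (fun i k => ?_)).symm
    · rw [mul_comm]; exact h1 k i
    · rw [mul_right_comm]; exact h2 k i

/-- The series `H_{n,m}(x,y;u) Φ / Φ` as a formal power series in `u`. It is defined through
`kernelRatio`, so that it makes sense for every `t ≠ 0`, see `nsSeries_kernelFun`. -/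
noncomputable def nsRatioSeries (q t : ℂ) {n m N M : ℕ} (x : Fin n → ℂ) (y : Fin m → ℂ)
    (z : Fin N → ℂ) (w : Fin M → ℂ) : PowerSeries ℂ :=
  PowerSeries.mk fun r => ∑ p ∈ nsIndex n m r, nsWeight q t x y p * kernelRatio q t x y z w p

theorem pow_succ_ne_one {q : ℂ} (hq : ‖q‖ < 1) (k : ℕ) : q ^ (k + 1) ≠ 1 := by
  intro h
  have := congrArg norm h
  rw [norm_pow, norm_one] at this
  exact (pow_lt_one₀ (norm_nonneg _) hq (Nat.succ_ne_zero k)).ne this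

theorem KernelGeneric.symm {q : ℂ} {n m N M : ℕ} {x : Fin n → ℂ} {y : Fin m → ℂ}
    {z : Fin N → ℂ} {w : Fin M → ℂ} (h : KernelGeneric q x y z w) : KernelGeneric q z w x y := by
  obtain ⟨h1, h2, h3, h4⟩ := h
  refine ⟨fun i j k => ?_, fun i j k => ?_, fun i j k => ?_, fun i j k => ?_⟩
  · rw [mul_comm (z i)]; exact h1 j i k
  · rw [mul_comm (z i)]; exact h4 j i k
  · rw [mul_comm (w i)]; exact h3 j i k
  · rw [mul_comm (w i)]; exact h2 j i k

theorem fuseNodes_injective {q : ℂ} (hq0 : q ≠ 0) (hq : ∀ k : ℕ, q ^ (k + 1) ≠ 1) (L : ℕ)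
    {n m : ℕ} {x : Fin n → ℂ} {y : Fin m → ℂ} (hr : NSRegular q x y) :
    Function.Injective (fuseNodes q L x y) := by
  obtain ⟨hx0, hy0, hxx, hyy, hxy⟩ := hr
  have hxy' : ∀ i j (k : ℕ), y j ≠ q ^ k * x i := fun i j k h =>
    hxy i j (k + 1) (by rw [h]; ring)
  rintro (j | ⟨i, k⟩) (j' | ⟨i', k'⟩) h
  · by_contra hne
    exact hyy j j' (fun e => hne (by rw [e])) h
  · exact absurd h (hxy' i' j k')
  · exact absurd h.symm (hxy' i j' k)
  · have h : q ^ (k : ℕ) * x i = q ^ (k' : ℕ) * x i' := h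
    by_cases hi : i = i'
    · subst hi
      rcases lt_trichotomy (k : ℕ) k' with hk | hk | hk
      · exact absurd h (pow_mul_ne_pow_mul hq0 hq (hx0 i) hk)
      · rw [Fin.ext hk]
      · exact absurd h.symm (pow_mul_ne_pow_mul hq0 hq (hx0 i) hk)
    · exact absurd h (pow_mul_ne_pow_mul' hq0 hxx hi _ _)

theorem fuseNodes_ne_zero {q : ℂ} (hq0 : q ≠ 0) (L : ℕ)
    {n m : ℕ} {x : Fin n → ℂ} {y : Fin m → ℂ} (hr : NSRegular q x y) (a) :
    fuseNodes q L x y a ≠ 0 := by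
  rcases a with j | ⟨i, k⟩
  · exact hr.2.1 j
  · exact mul_ne_zero (pow_ne_zero _ hq0) (hr.1 i)

theorem KernelGeneric.fuseNodes {q : ℂ} (L : ℕ) {n m N M : ℕ} {x : Fin n → ℂ} {y : Fin m → ℂ}
    {z : Fin N → ℂ} {w : Fin M → ℂ} (h : KernelGeneric q x y z w) (d : ℕ) (a b) :
    1 - q ^ d * (fuseNodes q L x y a * fuseNodes q L z w b) ≠ 0 := by
  obtain ⟨h1, h2, h3, h4⟩ := h
  rw [sub_ne_zero]
  symm
  rcases a with j | ⟨i, k⟩ <;> rcases b with j' | ⟨i', k'⟩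
  · exact h3 j j' d
  · convert h4 j i' (d + k') using 1
    simp only [_root_.fuseNodes, Sum.elim_inl, Sum.elim_inr, pow_add]; ring
  · convert h2 i j' (d + k) using 1
    simp only [_root_.fuseNodes, Sum.elim_inl, Sum.elim_inr, pow_add]; ring
  · convert h1 i i' (d + k + k') using 1
    simp only [_root_.fuseNodes, Sum.elim_inr, pow_add]; ring

theorem nsRatioSeries_eq_subsetSeries (q t : ℂ) (L : ℕ) (ht : t = (q ^ L)⁻¹) {n m N M : ℕ}
    (x : Fin n → ℂ) (y : Fin m → ℂ) (z : Fin N → ℂ) (w : Fin M → ℂ)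
    (hq0 : q ≠ 0) (hq : ∀ k : ℕ, q ^ (k + 1) ≠ 1) (hr : NSRegular q x y)
    (hg : KernelGeneric q x y z w) :
    nsRatioSeries q t x y z w = subsetSeries q t (fuseNodes q L x y) (fuseNodes q L z w) := by
  ext r
  rw [nsRatioSeries, subsetSeries, PowerSeries.coeff_mk, PowerSeries.coeff_mk,
    sum_subsetWeight_fuse q t L ht x y z w hq0 hq hr hg]

theorem zpow_mul_pow_eq_of_eq_inv_pow (q t : ℂ) (L : ℕ) (ht : t = (q ^ L)⁻¹) (hq0 : q ≠ 0)
    (n m : ℕ) : t ^ (1 - (n : ℤ)) * q ^ m = t * q ^ Fintype.card (Fin m ⊕ Fin n × Fin L) := by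
  have ht0 : t ≠ 0 := by rw [ht]; exact inv_ne_zero (pow_ne_zero _ hq0)
  have ht' : t⁻¹ = q ^ L := by rw [ht, inv_inv]
  simp only [Fintype.card_sum, Fintype.card_prod, Fintype.card_fin]
  rw [zpow_sub₀ ht0, zpow_one, zpow_natCast, div_eq_mul_inv, ← inv_pow, ht', pow_add, ← pow_mul,
    mul_comm L n]
  ring

/-- The kernel identity for `t = q ^ (-L)`: the deformed sums are source sums over strings. -/
theorem nsRatioSeries_symm_of_eq_inv_pow (q t : ℂ) (L : ℕ) (ht : t = (q ^ L)⁻¹) {n m N M : ℕ}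
    (x : Fin n → ℂ) (y : Fin m → ℂ) (z : Fin N → ℂ) (w : Fin M → ℂ)
    (hq0 : q ≠ 0) (hq1 : ‖q‖ < 1) (hr : NSRegular q x y) (hr' : NSRegular q z w)
    (hg : KernelGeneric q x y z w) :
    qPochSeries (t ^ (1 - (n : ℤ)) * q ^ m) q * nsRatioSeries q t x y z w
      = qPochSeries (t ^ (1 - (N : ℤ)) * q ^ M) q * nsRatioSeries q t z w x y := by
  have hq := pow_succ_ne_one hq1
  rw [nsRatioSeries_eq_subsetSeries q t L ht x y z w hq0 hq hr hg,
    nsRatioSeries_eq_subsetSeries q t L ht z w x y hq0 hq hr' hg.symm,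
    zpow_mul_pow_eq_of_eq_inv_pow q t L ht hq0, zpow_mul_pow_eq_of_eq_inv_pow q t L ht hq0]
  exact qPochSeries_mul_subsetSeries hq0 hq1 t _ _ (fuseNodes_injective hq0 hq L hr)
    (fuseNodes_injective hq0 hq L hr') (fuseNodes_ne_zero hq0 L hr) (fuseNodes_ne_zero hq0 L hr')
    (fun a b => by simpa using hg.fuseNodes L 0 a b)
    (fun a b => by simpa [mul_assoc] using hg.fuseNodes L 1 a b)

/-! ### Continuation in `t` -/

/-- `f` agrees with a Laurent polynomial away from `0`. -/
def IsLaurentPoly (f : ℂ → ℂ) : Prop :=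
  ∃ (K : ℕ) (P : Polynomial ℂ), ∀ t, t ≠ 0 → t ^ K * f t = P.eval t

namespace IsLaurentPoly

theorem const (c : ℂ) : IsLaurentPoly fun _ => c := ⟨0, Polynomial.C c, by simp⟩

theorem id : IsLaurentPoly fun t => t := ⟨0, Polynomial.X, by simp⟩

theorem inv : IsLaurentPoly fun t => t⁻¹ := ⟨1, 1, fun t ht => by simp [ht]⟩

theorem add {f g : ℂ → ℂ} (hf : IsLaurentPoly f) (hg : IsLaurentPoly g) :
    IsLaurentPoly fun t => f t + g t := by
  obtain ⟨K, P, hP⟩ := hf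
  obtain ⟨K', P', hP'⟩ := hg
  refine ⟨K + K', Polynomial.X ^ K' * P + Polynomial.X ^ K * P', fun t ht => ?_⟩
  simp only [Polynomial.eval_add, Polynomial.eval_mul, Polynomial.eval_pow, Polynomial.eval_X,
    ← hP t ht, ← hP' t ht]
  ring

theorem mul {f g : ℂ → ℂ} (hf : IsLaurentPoly f) (hg : IsLaurentPoly g) :
    IsLaurentPoly fun t => f t * g t := by
  obtain ⟨K, P, hP⟩ := hf
  obtain ⟨K', P', hP'⟩ := hg
  refine ⟨K + K', P * P', fun t ht => ?_⟩
  simp only [Polynomial.eval_mul, ← hP t ht, ← hP' t ht]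
  ring

theorem neg {f : ℂ → ℂ} (hf : IsLaurentPoly f) : IsLaurentPoly fun t => -f t := by
  simpa using (const (-1)).mul hf

theorem sub {f g : ℂ → ℂ} (hf : IsLaurentPoly f) (hg : IsLaurentPoly g) :
    IsLaurentPoly fun t => f t - g t := by
  simpa only [sub_eq_add_neg] using hf.add hg.neg

theorem div_const {f : ℂ → ℂ} (hf : IsLaurentPoly f) (c : ℂ) : IsLaurentPoly fun t => f t / c := by
  simpa only [div_eq_mul_inv] using hf.mul (const c⁻¹)

theorem pow {f : ℂ → ℂ} (hf : IsLaurentPoly f) (k : ℕ) : IsLaurentPoly fun t => f t ^ k := by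
  induction k with
  | zero => simpa using const 1
  | succ k ih => simpa only [pow_succ] using ih.mul hf

theorem zpow (k : ℤ) : IsLaurentPoly fun t => t ^ k := by
  cases k with
  | ofNat k => simpa using id.pow k
  | negSucc k => simpa [zpow_negSucc] using inv.pow (k + 1)

theorem sum {ι : Type*} (s : Finset ι) {f : ι → ℂ → ℂ} (hf : ∀ i ∈ s, IsLaurentPoly (f i)) :
    IsLaurentPoly fun t => ∑ i ∈ s, f i t := by
  classical
  induction s using Finset.induction_on with
  | empty => simpa using const 0
  | insert i s hi ih =>
    simp only [Finset.sum_insert hi]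
    exact (hf i (by simp)).add (ih fun j hj => hf j (by simp [hj]))

theorem prod {ι : Type*} (s : Finset ι) {f : ι → ℂ → ℂ} (hf : ∀ i ∈ s, IsLaurentPoly (f i)) :
    IsLaurentPoly fun t => ∏ i ∈ s, f i t := by
  classical
  induction s using Finset.induction_on with
  | empty => simpa using const 1
  | insert i s hi ih =>
    simp only [Finset.prod_insert hi]
    exact (hf i (by simp)).mul (ih fun j hj => hf j (by simp [hj]))

theorem qPoch {f : ℂ → ℂ} (hf : IsLaurentPoly f) (q : ℂ) (k : ℕ) :
    IsLaurentPoly fun t => qPoch (f t) q k :=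
  prod _ fun _ _ => (const 1).sub (hf.mul (const _))

/-- Laurent polynomials that agree at `q ^ (-L)` for all `L : ℕ` agree. -/
theorem congr_of_eq_inv_pow {f g : ℂ → ℂ} (hf : IsLaurentPoly f) (hg : IsLaurentPoly g) {q : ℂ}
    (hq0 : q ≠ 0) (hq1 : ‖q‖ < 1) (h : ∀ L : ℕ, f (q ^ L)⁻¹ = g (q ^ L)⁻¹) {t : ℂ} (ht : t ≠ 0) :
    f t = g t := by
  obtain ⟨K, P, hP⟩ := hf.sub hg
  have hP0 : P = 0 := by
    refine Polynomial.eq_zero_of_infinite_isRoot P (Set.infinite_of_injective_forall_mem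
      (f := fun L : ℕ => (q ^ L)⁻¹) ?_ fun L => ?_)
    · intro L L' hL
      have hL : q ^ L = q ^ L' := inv_injective hL
      have := congrArg norm hL
      rw [norm_pow, norm_pow] at this
      exact (pow_right_strictAnti₀ (norm_pos_iff.mpr hq0) hq1).injective this
    · change P.eval _ = 0
      have := hP _ (inv_ne_zero (pow_ne_zero L hq0))
      dsimp only at this
      rw [← this, h L, sub_self, mul_zero]
  have := hP t ht
  rw [hP0, Polynomial.eval_zero, mul_eq_zero] at this
  exact sub_eq_zero.mp (this.resolve_left (pow_ne_zero _ ht))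

end IsLaurentPoly

theorem isLaurentPoly_nsWeight (q : ℂ) {n m : ℕ} (x : Fin n → ℂ) (y : Fin m → ℂ)
    (p : (Fin n → ℕ) × Finset (Fin m)) : IsLaurentPoly fun t => nsWeight q t x y p := by
  have hd : ∀ a b : ℂ, IsLaurentPoly fun t => 1 - a / (t * b) := fun a b => by
    have := (IsLaurentPoly.const 1).sub ((IsLaurentPoly.const (a / b)).mul IsLaurentPoly.inv)
    convert this using 2 with t
    rw [← div_eq_mul_inv, div_div, mul_comm]
  unfold nsWeight nsCoeff
  refine ((((IsLaurentPoly.zpow _).mul (.const _)).pow _).mul (IsLaurentPoly.id.neg.pow _)).mul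
    (.const _) |>.mul ((((IsLaurentPoly.const _).mul ?_).mul (.const _)).mul ?_)
  · exact .prod _ fun i _ => .prod _ fun j _ =>
      (((IsLaurentPoly.id.mul (.const _)).div_const _).qPoch q _).div_const _
  · exact .prod _ fun i _ => .mul (.prod _ fun j _ => (hd _ _).div_const _) (.const _)

theorem isLaurentPoly_kernelRatio (q : ℂ) {n m N M : ℕ} (x : Fin n → ℂ) (y : Fin m → ℂ)
    (z : Fin N → ℂ) (w : Fin M → ℂ)
    (p : (Fin n → ℕ) × Finset (Fin m)) : IsLaurentPoly fun t => kernelRatio q t x y z w p := by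
  unfold kernelRatio
  refine ((IsLaurentPoly.mul ?_ (.const _)).mul (.const _)).mul ?_
  · exact .prod _ fun i _ => .prod _ fun j _ =>
      (((IsLaurentPoly.inv.mul (.const _)).mul (.const _)).qPoch q _).div_const _
  · exact .prod _ fun i _ => .prod _ fun j _ => ((IsLaurentPoly.const 1).sub
      ((IsLaurentPoly.inv.mul (.const _)).mul (.const _))).div_const _

theorem isLaurentPoly_coeff_nsRatioSeries (q : ℂ) (hq1 : ‖q‖ < 1) {n m N M : ℕ} (x : Fin n → ℂ)
    (y : Fin m → ℂ) (z : Fin N → ℂ) (w : Fin M → ℂ) (r : ℕ) :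
    IsLaurentPoly fun t => PowerSeries.coeff r
      (qPochSeries (t ^ (1 - (n : ℤ)) * q ^ m) q * nsRatioSeries q t x y z w) := by
  simp only [PowerSeries.coeff_mul]
  refine .sum _ fun d _ => .mul ?_ ?_
  · simp only [fun t : ℂ => qPochSeries_eq_rescale hq1 (t ^ (1 - (n : ℤ)) * q ^ m),
      PowerSeries.coeff_rescale]
    exact (((IsLaurentPoly.zpow _).mul (.const _)).pow _).mul (.const _)
  · simp only [nsRatioSeries, PowerSeries.coeff_mk]
    exact .sum _ fun p _ => (isLaurentPoly_nsWeight q x y p).mul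
      (isLaurentPoly_kernelRatio q x y z w p)

/-- The formal kernel identity divided by the kernel function, for every `t ≠ 0`. -/
theorem nsRatioSeries_symm (q t : ℂ) {n m N M : ℕ}
    (x : Fin n → ℂ) (y : Fin m → ℂ) (z : Fin N → ℂ) (w : Fin M → ℂ)
    (hq0 : q ≠ 0) (hq1 : ‖q‖ < 1) (ht : t ≠ 0) (hr : NSRegular q x y) (hr' : NSRegular q z w)
    (hg : KernelGeneric q x y z w) :
    qPochSeries (t ^ (1 - (n : ℤ)) * q ^ m) q * nsRatioSeries q t x y z w
      = qPochSeries (t ^ (1 - (N : ℤ)) * q ^ M) q * nsRatioSeries q t z w x y := by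
  ext r
  exact IsLaurentPoly.congr_of_eq_inv_pow (isLaurentPoly_coeff_nsRatioSeries q hq1 x y z w r)
    (isLaurentPoly_coeff_nsRatioSeries q hq1 z w x y r) hq0 hq1
    (fun L => by
      rw [nsRatioSeries_symm_of_eq_inv_pow q _ L rfl x y z w hq0 hq1 hr hr' hg]) ht

/-! ### The action on the kernel function -/

theorem kernelFun_symm (q t : ℂ) {n m N M : ℕ} (x : Fin n → ℂ) (y : Fin m → ℂ)
    (z : Fin N → ℂ) (w : Fin M → ℂ) : kernelFun q t x y z w = kernelFun q t z w x y := by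
  unfold kernelFun
  rw [Finset.prod_comm, Finset.prod_comm (s := (Finset.univ : Finset (Fin m))),
    Finset.prod_comm (f := fun i j => 1 - x i * w j),
    Finset.prod_comm (f := fun i j => 1 - y i * z j)]
  simp only [mul_comm (x _), mul_comm (y _), mul_assoc]
  ring

theorem KernelRegular.symm {q t : ℂ} {n m N M : ℕ} {x : Fin n → ℂ} {y : Fin m → ℂ}
    {z : Fin N → ℂ} {w : Fin M → ℂ} (h : KernelRegular q t x y z w) :
    KernelRegular q t z w x y :=
  ⟨fun i j k => by rw [mul_right_comm t⁻¹]; exact h.1 j i k,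
    fun i j k => by rw [mul_right_comm q]; exact h.2 j i k⟩

theorem KernelRegular.shift {q t : ℂ} {n m N M : ℕ} {x : Fin n → ℂ} {y : Fin m → ℂ}
    {z : Fin N → ℂ} {w : Fin M → ℂ} (h : KernelRegular q t x y z w)
    (p : (Fin n → ℕ) × Finset (Fin m)) :
    KernelRegular q t (fun i => q ^ p.1 i * x i) (fun j => if j ∈ p.2 then t⁻¹ * y j else y j)
      z w := by
  refine ⟨fun i j k => ?_, fun i j k => ?_⟩
  · convert h.1 i j (p.1 i + k) using 1
    rw [pow_add]; ring
  · dsimp only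
    split_ifs
    · convert h.2 i j (k + 1) using 1
      rw [pow_succ]; ring
    · exact h.2 i j k

/-- The action of the shift operators on the kernel function. -/
theorem kernelFun_shift {q t : ℂ} (hq1 : ‖q‖ < 1) (ht : 1 < ‖t‖) {n m N M : ℕ} {x : Fin n → ℂ}
    {y : Fin m → ℂ} {z : Fin N → ℂ} {w : Fin M → ℂ} (hΦ : KernelRegular q t x y z w)
    (hg : KernelGeneric q x y z w) (p : (Fin n → ℕ) × Finset (Fin m)) :
    kernelFun q t (fun i => q ^ p.1 i * x i) (fun j => if j ∈ p.2 then t⁻¹ * y j else y j) z w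
      = kernelRatio q t x y z w p * kernelFun q t x y z w := by
  have ht1 : ‖t⁻¹‖ < 1 := by rw [norm_inv]; exact inv_lt_one_of_one_lt₀ ht
  obtain ⟨g1, g2, g3, g4⟩ := hg
  have k1 : ∏ i, ∏ j, qPochInf (q ^ p.1 i * x i * z j) q
        / qPochInf (t⁻¹ * (q ^ p.1 i * x i) * z j) q
      = (∏ i, ∏ j, qPoch (t⁻¹ * x i * z j) q (p.1 i) / qPoch (x i * z j) q (p.1 i))
        * ∏ i, ∏ j, qPochInf (x i * z j) q / qPochInf (t⁻¹ * x i * z j) q := by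
    simp only [← Finset.prod_mul_distrib]
    refine Finset.prod_congr rfl fun i _ => Finset.prod_congr rfl fun j _ => ?_
    rw [qPochInf_eq_qPoch_mul hq1 (x i * z j) (p.1 i),
      qPochInf_eq_qPoch_mul hq1 (t⁻¹ * x i * z j) (p.1 i)]
    have h1 : qPoch (x i * z j) q (p.1 i) ≠ 0 := Finset.prod_ne_zero_iff.mpr fun k _ =>
      sub_ne_zero.mpr (by rw [mul_comm]; exact (g1 i j k).symm)
    have h2 : qPoch (t⁻¹ * x i * z j) q (p.1 i) ≠ 0 := Finset.prod_ne_zero_iff.mpr fun k _ =>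
      sub_ne_zero.mpr (hΦ.1 i j k).symm
    rw [div_mul_div_comm, mul_left_comm, mul_left_comm (qPoch (x i * z j) q (p.1 i)),
      mul_div_mul_left _ _ h2, mul_div_mul_left _ _ h1]
    congr 2 <;> ring
  have k2 : ∏ i, ∏ j, qPochInf ((if i ∈ p.2 then t⁻¹ * y i else y i) * w j) t⁻¹
        / qPochInf (q * (if i ∈ p.2 then t⁻¹ * y i else y i) * w j) t⁻¹
      = (∏ i ∈ p.2, ∏ j, (1 - q * y i * w j) / (1 - y i * w j))
        * ∏ i, ∏ j, qPochInf (y i * w j) t⁻¹ / qPochInf (q * y i * w j) t⁻¹ := by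
    rw [← prod_ite_mem_univ p.2]
    simp only [← prod_ite_irrel_one, ← Finset.prod_mul_distrib]
    refine Finset.prod_congr rfl fun i _ => Finset.prod_congr rfl fun j _ => ?_
    by_cases hi : i ∈ p.2
    · rw [if_pos hi, if_pos hi, qPochInf_eq_qPoch_mul ht1 (y i * w j) 1,
        qPochInf_eq_qPoch_mul ht1 (q * y i * w j) 1]
      have h1 : 1 - y i * w j ≠ 0 := sub_ne_zero.mpr (by simpa using (g3 i j 0).symm)
      have h2 : 1 - q * y i * w j ≠ 0 := sub_ne_zero.mpr (by simpa using (hΦ.2 i j 0).symm)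
      simp only [qPoch, Finset.prod_range_one, pow_zero, mul_one, pow_one]
      rw [div_mul_div_comm, mul_left_comm, mul_left_comm (1 - y i * w j),
        mul_div_mul_left _ _ h2, mul_div_mul_left _ _ h1]
      congr 2 <;> ring
    · rw [if_neg hi, if_neg hi, one_mul]
  have k3 : ∏ i, ∏ j, (1 - q ^ p.1 i * x i * w j)
      = (∏ i, ∏ j, (1 - q ^ p.1 i * x i * w j) / (1 - x i * w j))
        * ∏ i, ∏ j, (1 - x i * w j) := by
    simp only [← Finset.prod_mul_distrib]
    refine Finset.prod_congr rfl fun i _ => Finset.prod_congr rfl fun j _ => ?_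
    rw [div_mul_cancel₀]
    exact sub_ne_zero.mpr (by simpa using (g2 i j 0).symm)
  have k4 : ∏ i, ∏ j, (1 - (if i ∈ p.2 then t⁻¹ * y i else y i) * z j)
      = (∏ i ∈ p.2, ∏ j, (1 - t⁻¹ * y i * z j) / (1 - y i * z j))
        * ∏ i, ∏ j, (1 - y i * z j) := by
    rw [← prod_ite_mem_univ p.2]
    simp only [← prod_ite_irrel_one, ← Finset.prod_mul_distrib]
    refine Finset.prod_congr rfl fun i _ => Finset.prod_congr rfl fun j _ => ?_
    by_cases hi : i ∈ p.2
    · rw [if_pos hi, if_pos hi, div_mul_cancel₀]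
      exact sub_ne_zero.mpr (by simpa using (g4 i j 0).symm)
    · rw [if_neg hi, if_neg hi, one_mul]
  unfold kernelFun
  dsimp only
  rw [k1, k2, k3, k4, kernelRatio]
  ring

theorem nsOp_eq_sum (q t : ℂ) {n m : ℕ} (r : ℕ) (f : (Fin n → ℂ) → (Fin m → ℂ) → ℂ)
    (x : Fin n → ℂ) (y : Fin m → ℂ) :
    nsOp q t r f x y = ∑ p ∈ nsIndex n m r, nsTerm q t f x y p := by
  rw [sum_nsIndex]; rfl

theorem nsSeries_kernelFun {q t : ℂ} (hq1 : ‖q‖ < 1) (ht : 1 < ‖t‖) {n m N M : ℕ} {x : Fin n → ℂ}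
    {y : Fin m → ℂ} {z : Fin N → ℂ} {w : Fin M → ℂ} (hΦ : KernelRegular q t x y z w)
    (hg : KernelGeneric q x y z w) :
    nsSeries q t (fun x' y' => kernelFun q t x' y' z w) x y
      = PowerSeries.C (kernelFun q t x y z w) * nsRatioSeries q t x y z w := by
  ext r
  rw [PowerSeries.coeff_C_mul, nsSeries, nsRatioSeries, PowerSeries.coeff_mk, PowerSeries.coeff_mk,
    nsOp_eq_sum, Finset.mul_sum]
  refine Finset.sum_congr rfl fun p _ => ?_
  rw [nsTerm, kernelFun_shift hq1 ht hΦ hg, nsWeight]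
  ring

/-- The formal kernel identity at points in general position. -/
theorem nsSeries_identity_of_generic {q t : ℂ} (hq0 : q ≠ 0) (hq1 : ‖q‖ < 1) (ht : 1 < ‖t‖)
    {n m N M : ℕ} {x : Fin n → ℂ} {y : Fin m → ℂ} {z : Fin N → ℂ} {w : Fin M → ℂ}
    (hΦ : KernelRegular q t x y z w) (hg : KernelGeneric q x y z w) (hr : NSRegular q x y)
    (hr' : NSRegular q z w) :
    qPochSeries (t ^ (1 - (n : ℤ)) * q ^ m) q
        * nsSeries q t (fun x' y' => kernelFun q t x' y' z w) x y
      = qPochSeries (t ^ (1 - (N : ℤ)) * q ^ M) q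
        * nsSeries q t (fun z' w' => kernelFun q t x y z' w') z w := by
  have ht0 : t ≠ 0 := norm_pos_iff.mp (zero_lt_one.trans ht)
  simp only [kernelFun_symm q t x y]
  rw [nsSeries_kernelFun hq1 ht hΦ.symm hg.symm]
  simp only [← kernelFun_symm q t x y]
  rw [nsSeries_kernelFun hq1 ht hΦ hg, mul_left_comm, mul_left_comm (qPochSeries _ q),
    nsRatioSeries_symm q t x y z w hq0 hq1 ht0 hr hr' hg]

/-! ### Dilations and special positions -/

theorem vandermondeProd_smul (s : ℂ) {n : ℕ} (x : Fin n → ℂ) :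
    vandermondeProd (fun i => s * x i)
      = (∏ i : Fin n, ∏ _j ∈ Finset.Ioi i, s) * vandermondeProd x := by
  unfold vandermondeProd
  simp only [← Finset.prod_mul_distrib, mul_sub]

theorem nsCoeff_smul (q t : ℂ) {s : ℂ} (hs : s ≠ 0) {n m : ℕ} (μ : Fin n → ℕ)
    (I : Finset (Fin m)) (x : Fin n → ℂ) (y : Fin m → ℂ) :
    nsCoeff q t μ I (fun i => s * x i) (fun j => s * y j) = nsCoeff q t μ I x y := by
  have hc : ∀ c a b : ℂ, c * (s * a) / (s * b) = c * a / b := fun c a b => by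
    rw [mul_left_comm, mul_div_mul_left _ _ hs]
  have hd : ∀ c a b : ℂ, s * a / (c * (s * b)) = a / (c * b) := fun c a b => by
    rw [mul_left_comm c, mul_div_mul_left _ _ hs]
  have he : ∀ a b : ℂ, (s * a - q * (s * b)) / (s * a - s * b) = (a - q * b) / (a - b) :=
    fun a b => by rw [mul_left_comm, ← mul_sub, ← mul_sub, mul_div_mul_left _ _ hs]
  have hp : (∏ i : Fin n, ∏ _j ∈ Finset.Ioi i, s) ≠ 0 :=
    Finset.prod_ne_zero_iff.mpr fun _ _ => Finset.prod_ne_zero_iff.mpr fun _ _ => hs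
  unfold nsCoeff
  rw [vandermondeProd_smul s x, show (fun i => q ^ μ i * (s * x i)) = fun i => s * (q ^ μ i * x i)
    from funext fun i => by ring, vandermondeProd_smul, mul_div_mul_left _ _ hp]
  simp only [hc, hd, he]

theorem nsTerm_smul (q t : ℂ) {s : ℂ} (hs : s ≠ 0) {n m : ℕ}
    (f : (Fin n → ℂ) → (Fin m → ℂ) → ℂ) (x : Fin n → ℂ) (y : Fin m → ℂ)
    (p : (Fin n → ℕ) × Finset (Fin m)) :
    nsTerm q t f (fun i => s * x i) (fun j => s * y j) p
      = nsTerm q t (fun x' y' => f (fun i => s * x' i) (fun j => s * y' j)) x y p := by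
  unfold nsTerm
  rw [nsCoeff_smul q t hs]
  congr 2
  · exact funext fun i => by ring
  · refine funext fun j => ?_
    by_cases hj : j ∈ p.2
    · simp only [hj, if_true]; ring
    · simp only [hj, if_false]

theorem nsSeries_smul (q t : ℂ) {s : ℂ} (hs : s ≠ 0) {n m : ℕ}
    (f : (Fin n → ℂ) → (Fin m → ℂ) → ℂ) (x : Fin n → ℂ) (y : Fin m → ℂ) :
    nsSeries q t f (fun i => s * x i) (fun j => s * y j)
      = nsSeries q t (fun x' y' => f (fun i => s * x' i) (fun j => s * y' j)) x y := by
  unfold nsSeries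
  simp only [nsOp_eq_sum, nsTerm_smul q t hs]

theorem NSRegular.smul {q s : ℂ} (hs : s ≠ 0) {n m : ℕ} {x : Fin n → ℂ} {y : Fin m → ℂ}
    (h : NSRegular q x y) : NSRegular q (fun i => s * x i) (fun j => s * y j) := by
  obtain ⟨h1, h2, h3, h4, h5⟩ := h
  refine ⟨fun i => mul_ne_zero hs (h1 i), fun j => mul_ne_zero hs (h2 j), fun i j hij k h => ?_,
    fun i j hij h => h4 i j hij (mul_left_cancel₀ hs h), fun i j k h => ?_⟩
  · rw [mul_left_comm] at h
    exact h3 i j hij k (mul_left_cancel₀ hs h)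
  · rw [mul_left_comm, mul_left_comm q] at h
    exact h5 i j k (mul_left_cancel₀ hs h)

theorem continuousAt_kernelFun {q t : ℂ} (hq1 : ‖q‖ < 1) (ht : 1 < ‖t‖) {n m N M : ℕ}
    {x : Fin n → ℂ} {y : Fin m → ℂ} {z : Fin N → ℂ} {w : Fin M → ℂ}
    (hΦ : KernelRegular q t x y z w) :
    ContinuousAt (fun s : ℂ => kernelFun q t x y (fun i => s * z i) (fun j => s * w j)) 1 := by
  have ht1 : ‖t⁻¹‖ < 1 := by rw [norm_inv]; exact inv_lt_one_of_one_lt₀ ht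
  have hc := continuous_qPochInf hq1
  have hc' := continuous_qPochInf ht1
  unfold kernelFun
  refine ((ContinuousAt.mul ?_ ?_).mul (Continuous.continuousAt (by fun_prop))).mul
    (Continuous.continuousAt (by fun_prop))
  · refine tendsto_finsetProd _ fun i _ => tendsto_finsetProd _ fun j _ => ContinuousAt.div
      (Continuous.continuousAt (hc.comp (by fun_prop : Continuous fun s : ℂ => x i * (s * z j))))
      (Continuous.continuousAt
        (hc.comp (by fun_prop : Continuous fun s : ℂ => t⁻¹ * x i * (s * z j)))) ?_
    refine qPochInf_ne_zero hq1 fun k => ?_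
    simpa only [one_mul] using hΦ.1 i j k
  · refine tendsto_finsetProd _ fun i _ => tendsto_finsetProd _ fun j _ => ContinuousAt.div
      (Continuous.continuousAt (hc'.comp (by fun_prop : Continuous fun s : ℂ => y i * (s * w j))))
      (Continuous.continuousAt
        (hc'.comp (by fun_prop : Continuous fun s : ℂ => q * y i * (s * w j)))) ?_
    refine qPochInf_ne_zero ht1 fun k => ?_
    simpa only [one_mul] using hΦ.2 i j k

theorem continuousAt_coeff_nsSeries {q t : ℂ} (hq1 : ‖q‖ < 1) (ht : 1 < ‖t‖) {n m N M : ℕ}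
    {x : Fin n → ℂ} {y : Fin m → ℂ} {z : Fin N → ℂ} {w : Fin M → ℂ}
    (hΦ : KernelRegular q t x y z w) (A : PowerSeries ℂ) (r : ℕ) :
    ContinuousAt (fun s : ℂ => PowerSeries.coeff r (A * nsSeries q t
      (fun x' y' => kernelFun q t x' y' (fun i => s * z i) (fun j => s * w j)) x y)) 1 := by
  simp only [PowerSeries.coeff_mul, nsSeries, PowerSeries.coeff_mk, nsOp_eq_sum]
  refine tendsto_finsetSum _ fun d _ => Filter.Tendsto.const_mul _
    (tendsto_finsetSum _ fun p _ => ?_)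
  unfold nsTerm
  exact Filter.Tendsto.const_mul _ (continuousAt_kernelFun hq1 ht (hΦ.shift p))

theorem countable_setOf_mul_eq_one {ι : Type*} [Countable ι] (c : ι → ℂ) :
    {s : ℂ | ∃ i, s * c i = 1}.Countable := by
  have : {s : ℂ | ∃ i, s * c i = 1} ⊆ Set.range fun i => (c i)⁻¹ := by
    rintro s ⟨i, hi⟩
    exact ⟨i, (eq_inv_of_mul_eq_one_left hi).symm⟩
  exact (Set.countable_range _).mono this

/-- Almost every dilation of the second group of variables is in general position. -/
theorem dense_setOf_generic (q t : ℂ) {n m N M : ℕ} (x : Fin n → ℂ) (y : Fin m → ℂ)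
    (z : Fin N → ℂ) (w : Fin M → ℂ) :
    Dense {s : ℂ | s ≠ 0 ∧ KernelRegular q t x y (fun i => s * z i) (fun j => s * w j)
      ∧ KernelGeneric q x y (fun i => s * z i) (fun j => s * w j)} := by
  let S : Set ℂ := ((((({s | ∃ p : Fin n × Fin N × ℕ, s * (t⁻¹ * x p.1 * z p.2.1 * q ^ p.2.2) = 1}
    ∪ {s | ∃ p : Fin m × Fin M × ℕ, s * (q * y p.1 * w p.2.1 * t⁻¹ ^ p.2.2) = 1})
    ∪ {s | ∃ p : Fin n × Fin N × ℕ, s * (q ^ p.2.2 * (x p.1 * z p.2.1)) = 1})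
    ∪ {s | ∃ p : Fin n × Fin M × ℕ, s * (q ^ p.2.2 * (x p.1 * w p.2.1)) = 1})
    ∪ {s | ∃ p : Fin m × Fin M × ℕ, s * (q ^ p.2.2 * (y p.1 * w p.2.1)) = 1})
    ∪ {s | ∃ p : Fin m × Fin N × ℕ, s * (q ^ p.2.2 * (y p.1 * z p.2.1)) = 1}) ∪ {0}
  have hS : S.Countable := ((((((countable_setOf_mul_eq_one _).union
    (countable_setOf_mul_eq_one _)).union (countable_setOf_mul_eq_one _)).union
    (countable_setOf_mul_eq_one _)).union (countable_setOf_mul_eq_one _)).union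
    (countable_setOf_mul_eq_one _)).union (Set.countable_singleton 0)
  refine (hS.dense_compl ℝ).mono fun s hs => ?_
  simp only [S, Set.mem_compl_iff, Set.mem_union, not_or] at hs
  obtain ⟨⟨⟨⟨⟨⟨h1, h2⟩, h3⟩, h4⟩, h5⟩, h6⟩, h0⟩ := hs
  refine ⟨h0, ⟨fun i j k h => h1 ⟨(i, j, k), ?_⟩, fun i j k h => h2 ⟨(i, j, k), ?_⟩⟩,
    fun i j k h => h3 ⟨(i, j, k), ?_⟩, fun i j k h => h4 ⟨(i, j, k), ?_⟩,
    fun i j k h => h5 ⟨(i, j, k), ?_⟩, fun i j k h => h6 ⟨(i, j, k), ?_⟩⟩ <;>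
  · rw [← h]; ring

theorem ContinuousAt.eq_of_dense {f g : ℂ → ℂ} {a : ℂ} (hf : ContinuousAt f a)
    (hg : ContinuousAt g a) {S : Set ℂ} (hS : Dense S) (h : ∀ s ∈ S, f s = g s) : f a = g a := by
  by_contra hne
  obtain ⟨s, hs1, hs2⟩ := hS.inter_nhds_nonempty (hf.ne_iff_eventually_ne hg |>.mp hne)
  exact hs2 (h s hs1)

/-- The formal kernel identity, cleared of the common factor `(t u; q)_∞`. At special positions it
follows from the generic case by continuity, dilating the second group of variables. -/
theorem nsSeries_identity {q t : ℂ} (hq0 : q ≠ 0) (hq1 : ‖q‖ < 1) (ht : 1 < ‖t‖)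
    {n m N M : ℕ} {x : Fin n → ℂ} {y : Fin m → ℂ} {z : Fin N → ℂ} {w : Fin M → ℂ}
    (hΦ : KernelRegular q t x y z w) (hr : NSRegular q x y) (hr' : NSRegular q z w) :
    qPochSeries (t ^ (1 - (n : ℤ)) * q ^ m) q
        * nsSeries q t (fun x' y' => kernelFun q t x' y' z w) x y
      = qPochSeries (t ^ (1 - (N : ℤ)) * q ^ M) q
        * nsSeries q t (fun z' w' => kernelFun q t x y z' w') z w := by
  -- the kernel function only depends on products of variables of the two groups
  have hsw : ∀ (s : ℂ) (z' : Fin N → ℂ) (w' : Fin M → ℂ),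
      kernelFun q t x y (fun i => s * z' i) (fun j => s * w' j)
      = kernelFun q t z' w' (fun i => s * x i) (fun j => s * y j) := by
    intro s z' w'
    rw [kernelFun_symm]
    unfold kernelFun
    simp only [mul_assoc, mul_left_comm s]
  ext r
  have h1 := continuousAt_coeff_nsSeries hq1 ht hΦ (x := x) (y := y)
    (qPochSeries (t ^ (1 - (n : ℤ)) * q ^ m) q) r
  have h2 := continuousAt_coeff_nsSeries hq1 ht hΦ.symm (x := z) (y := w)
    (qPochSeries (t ^ (1 - (N : ℤ)) * q ^ M) q) r
  have := h1.eq_of_dense h2 (dense_setOf_generic q t x y z w) (by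
    rintro s ⟨hs, hΦs, hgs⟩
    have := nsSeries_identity_of_generic hq0 hq1 ht hΦs hgs hr (hr'.smul hs)
    rw [this, nsSeries_smul q t hs]
    simp only [hsw])
  simp only [one_mul] at this
  rw [this]
  simp only [kernelFun_symm q t x y]

theorem nsSeriesRenorm_identity {q t : ℂ} (hq0 : q ≠ 0) (hq1 : ‖q‖ < 1) (ht : 1 < ‖t‖)
    {n m N M : ℕ} {x : Fin n → ℂ} {y : Fin m → ℂ} {z : Fin N → ℂ} {w : Fin M → ℂ}
    (hΦ : KernelRegular q t x y z w) (hr : NSRegular q x y) (hr' : NSRegular q z w) :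
    nsSeriesRenorm q t (fun x' y' => kernelFun q t x' y' z w) x y
      = nsSeriesRenorm q t (fun z' w' => kernelFun q t x y z' w') z w := by
  unfold nsSeriesRenorm
  rw [mul_right_comm, nsSeries_identity hq0 hq1 ht hΦ hr hr', mul_right_comm]

/-! ### Absolute convergence -/

theorem summable_pow_sum {n : ℕ} {ρ : ℝ} (h0 : 0 ≤ ρ) (h : n ≠ 0 → ρ < 1) :
    Summable fun μ : Fin n → ℕ => ρ ^ ∑ i, μ i := by
  induction n with
  | zero => exact summable_of_hasFiniteSupport (Set.toFinite _)
  | succ n ih =>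
    have h1 := h (Nat.succ_ne_zero n)
    have := (summable_geometric_of_lt_one h0 h1).mul_of_nonneg (ih fun _ => h1)
      (fun _ => by positivity) (fun _ => by positivity)
    rw [← (Fin.consEquiv fun _ : Fin (n + 1) => ℕ).summable_iff]
    refine this.congr fun p => ?_
    simp [Fin.consEquiv, Fin.sum_univ_succ, pow_add]

/-- `f` is bounded in norm. -/
def NormBounded {α : Type*} (f : α → ℂ) : Prop := ∃ C, ∀ a, ‖f a‖ ≤ C

namespace NormBounded

variable {α : Type*}

theorem const (c : ℂ) : NormBounded fun _ : α => c := ⟨‖c‖, fun _ => le_rfl⟩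

theorem mul {f g : α → ℂ} (hf : NormBounded f) (hg : NormBounded g) :
    NormBounded fun a => f a * g a := by
  obtain ⟨C, hC⟩ := hf
  obtain ⟨D, hD⟩ := hg
  exact ⟨C * D, fun a => (norm_mul _ _).le.trans
    (mul_le_mul (hC a) (hD a) (norm_nonneg _) ((norm_nonneg _).trans (hC a)))⟩

theorem sub {f g : α → ℂ} (hf : NormBounded f) (hg : NormBounded g) :
    NormBounded fun a => f a - g a := by
  obtain ⟨C, hC⟩ := hf
  obtain ⟨D, hD⟩ := hg
  exact ⟨C + D, fun a => (norm_sub_le _ _).trans (add_le_add (hC a) (hD a))⟩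

theorem div_const {f : α → ℂ} (hf : NormBounded f) (c : ℂ) : NormBounded fun a => f a / c := by
  simpa only [div_eq_mul_inv] using hf.mul (const c⁻¹)

theorem prod {ι : Type*} (s : Finset ι) {f : ι → α → ℂ} (hf : ∀ i ∈ s, NormBounded (f i)) :
    NormBounded fun a => ∏ i ∈ s, f i a := by
  classical
  induction s using Finset.induction_on with
  | empty => simpa using const 1
  | insert i s hi ih =>
    simp only [Finset.prod_insert hi]
    exact (hf i (by simp)).mul (ih fun j hj => hf j (by simp [hj]))

theorem of_tendsto {f : ℕ → ℂ} {l : ℂ} (hf : Filter.Tendsto f Filter.atTop (nhds l)) (g : α → ℕ) :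
    NormBounded fun a => f (g a) := by
  obtain ⟨C, hC⟩ := (Metric.isBounded_range_of_tendsto f hf).exists_norm_le
  exact ⟨C, fun a => hC _ ⟨g a, rfl⟩⟩

end NormBounded

theorem tendsto_pow_mul_zero {q : ℂ} (hq : ‖q‖ < 1) (a : ℂ) :
    Filter.Tendsto (fun k : ℕ => q ^ k * a) Filter.atTop (nhds 0) := by
  simpa using (tendsto_pow_atTop_nhds_zero_of_norm_lt_one hq).mul_const a

theorem tendsto_qPoch {q : ℂ} (hq : ‖q‖ < 1) (a : ℂ) :
    Filter.Tendsto (fun k => qPoch a q k) Filter.atTop (nhds (qPochInf a q)) :=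
  (multipliable_one_sub_mul_pow hq a).hasProd.tendsto_prod_nat

theorem tendsto_qPochInf_one {q : ℂ} (hq : ‖q‖ < 1) {f : ℕ → ℂ}
    (hf : Filter.Tendsto f Filter.atTop (nhds 0)) :
    Filter.Tendsto (fun k => qPochInf (f k) q) Filter.atTop (nhds 1) := by
  have := ((continuous_qPochInf hq).tendsto 0).comp hf
  rwa [qPochInf_zero] at this

theorem normBounded_nsCoeff {q : ℂ} (t : ℂ) (hq0 : q ≠ 0) (hq1 : ‖q‖ < 1) {n m : ℕ}
    {x : Fin n → ℂ} {y : Fin m → ℂ} (hr : NSRegular q x y) (I : Finset (Fin m)) :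
    NormBounded fun μ => nsCoeff q t μ I x y := by
  obtain ⟨hx0, hy0, hxx, hyy, hxy⟩ := hr
  unfold nsCoeff vandermondeProd
  refine ((NormBounded.mul (NormBounded.div_const ?_ _) ?_).mul (.const _)).mul ?_
  · exact .prod _ fun i _ => .prod _ fun j _ =>
      (NormBounded.of_tendsto (tendsto_pow_mul_zero hq1 (x i)) (fun μ : Fin n → ℕ => μ i)).sub
      (NormBounded.of_tendsto (tendsto_pow_mul_zero hq1 (x j)) (fun μ : Fin n → ℕ => μ j))
  · refine .prod _ fun i _ => .prod _ fun j _ => NormBounded.of_tendsto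
      (f := fun k => qPoch (t * x i / x j) q k / qPoch (q * x i / x j) q k)
      ((tendsto_qPoch hq1 _).div (tendsto_qPoch hq1 _) ?_) fun μ : Fin n → ℕ => μ i
    refine qPochInf_ne_zero hq1 fun k h => ?_
    have h0 := hx0 j
    have h' : q ^ (k + 1) * x i = x j := by
      field_simp at h
      linear_combination h
    by_cases hij : i = j
    · subst hij
      exact pow_succ_ne_one hq1 k (mul_right_cancel₀ h0 (by rw [h', one_mul]))
    · exact hxx i j hij _ h'
  · refine .prod _ fun i _ => .mul (.prod _ fun j _ => ?_) (.prod _ fun j _ => ?_)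
    · refine NormBounded.of_tendsto (f := fun k : ℕ => (1 - x i / (t * y j)) /
        (1 - q ^ k * x i / y j)) (l := (1 - x i / (t * y j)) / (1 - 0 / y j))
        (Filter.Tendsto.div tendsto_const_nhds (Filter.Tendsto.sub tendsto_const_nhds
          ((tendsto_pow_mul_zero hq1 (x i)).div_const _)) ?_) fun μ : Fin n → ℕ => μ i
      simp
    · refine NormBounded.of_tendsto (f := fun k : ℕ => (1 - x i / (q * y j)) /
        (1 - q ^ ((k : ℤ) - 1) * x i / y j)) (l := (1 - x i / (q * y j)) / (1 - 0 / y j))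
        (Filter.Tendsto.div tendsto_const_nhds (Filter.Tendsto.sub tendsto_const_nhds
          (Filter.Tendsto.div_const ?_ _)) ?_) fun μ : Fin n → ℕ => μ i
      · refine (tendsto_pow_mul_zero hq1 (q⁻¹ * x i)).congr fun k => ?_
        rw [zpow_sub₀ hq0, zpow_natCast, zpow_one]
        ring
      · simp

theorem normBounded_kernelFun {q t : ℂ} (hq1 : ‖q‖ < 1) {n m N M : ℕ}
    (x : Fin n → ℂ) (y : Fin m → ℂ) (z : Fin N → ℂ) (w : Fin M → ℂ) :
    NormBounded fun μ : Fin n → ℕ => kernelFun q t (fun i => q ^ μ i * x i) y z w := by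
  unfold kernelFun
  refine ((NormBounded.mul ?_ (.const _)).mul ?_).mul (.const _)
  · refine .prod _ fun i _ => .prod _ fun j _ => NormBounded.of_tendsto
      (f := fun k => qPochInf (q ^ k * x i * z j) q / qPochInf (t⁻¹ * (q ^ k * x i) * z j) q)
      ((tendsto_qPochInf_one hq1 ?_).div (tendsto_qPochInf_one hq1 ?_) one_ne_zero)
      fun μ : Fin n → ℕ => μ i
    · simpa [mul_assoc] using tendsto_pow_mul_zero hq1 (x i * z j)
    · refine (tendsto_pow_mul_zero hq1 (t⁻¹ * x i * z j)).congr fun k => by ring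
  · exact .prod _ fun i _ => .prod _ fun j _ => (NormBounded.const 1).sub
      ((NormBounded.of_tendsto (tendsto_pow_mul_zero hq1 (x i)) (fun μ : Fin n → ℕ => μ i)).mul
        (.const _))

/-- Absolute convergence: the coefficient functions and the shifted kernel functions are bounded
uniformly in `μ`, so that the series is dominated by a multiple geometric series. -/
theorem summable_nsGenTerm {q t u : ℂ} (hq0 : q ≠ 0) (hq1 : ‖q‖ < 1) {n m N M : ℕ}
    {x : Fin n → ℂ} {y : Fin m → ℂ} (z : Fin N → ℂ) (w : Fin M → ℂ)
    (hr : NSRegular q x y) (hu : n ≠ 0 → ‖t ^ (1 - (n : ℤ)) * q ^ m * u‖ < 1) :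
    Summable (nsGenTerm q t u (fun x' y' => kernelFun q t x' y' z w) x y) := by
  have hb : ∀ I : Finset (Fin m), NormBounded fun μ : Fin n → ℕ =>
      u ^ I.card * ((-t) ^ I.card * q ^ I.card.choose 2 * nsCoeff q t μ I x y
        * kernelFun q t (fun i => q ^ μ i * x i) (fun j => if j ∈ I then t⁻¹ * y j else y j) z w) :=
    fun I => (NormBounded.const _).mul (((NormBounded.const _).mul
      (normBounded_nsCoeff t hq0 hq1 hr I)).mul (normBounded_kernelFun hq1 x _ z w))
  choose C hC using hb
  have hC0 : ∀ I, 0 ≤ C I := fun I => (norm_nonneg _).trans (hC I 0)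
  have hs := (summable_pow_sum (norm_nonneg (t ^ (1 - (n : ℤ)) * q ^ m * u)) hu).mul_of_nonneg
    (summable_of_hasFiniteSupport (f := C) (Set.toFinite _)) (fun _ => by positivity) hC0
  refine hs.of_norm_bounded fun p => ?_
  have : nsGenTerm q t u (fun x' y' => kernelFun q t x' y' z w) x y p
      = (t ^ (1 - (n : ℤ)) * q ^ m * u) ^ (∑ i, p.1 i)
        * (u ^ p.2.card * ((-t) ^ p.2.card * q ^ p.2.card.choose 2 * nsCoeff q t p.1 p.2 x y
        * kernelFun q t (fun i => q ^ p.1 i * x i)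
          (fun j => if j ∈ p.2 then t⁻¹ * y j else y j) z w)) := by
    rw [nsGenTerm, nsTerm, pow_add, mul_pow (t ^ (1 - (n : ℤ)) * q ^ m) u]
    ring
  rw [this, norm_mul, norm_pow]
  exact mul_le_mul_of_nonneg_left (hC p.2 p.1) (by positivity)

/-! ### The kernel identities -/

/-- Summing the absolutely convergent series `H_{n,m}(x,y;u) f` by total degree. -/
theorem hasValue_nsSeries {q t u : ℂ} {n m : ℕ} {f : (Fin n → ℂ) → (Fin m → ℂ) → ℂ}
    {x : Fin n → ℂ} {y : Fin m → ℂ} (h : Summable (nsGenTerm q t u f x y)) :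
    (nsSeries q t f x y).HasValue u (nsGen q t u f x y) := by
  have h1 := h.hasSum.tsum_fiberwise
    fun p : (Fin n → ℕ) × Finset (Fin m) => ∑ i, p.1 i + p.2.card
  unfold PowerSeries.HasValue nsGen
  refine (congrArg (fun F => HasSum F _) (funext fun r => ?_)).mp h1
  have hset : (fun p : (Fin n → ℕ) × Finset (Fin m) => ∑ i, p.1 i + p.2.card) ⁻¹' {r}
      = ↑(nsIndex n m r) := by
    ext p
    simp [mem_nsIndex]
  rw [hset, Finset.tsum_subtype' (nsIndex n m r) (nsGenTerm q t u f x y), nsSeries,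
    PowerSeries.coeff_mk, nsOp_eq_sum, Finset.sum_mul]
  refine Finset.sum_congr rfl fun p hp => ?_
  rw [nsGenTerm, (mem_nsIndex p).mp hp, mul_comm]

theorem nsGenRenorm_identity {q t u : ℂ} (hq0 : q ≠ 0) (hq1 : ‖q‖ < 1) (ht : 1 < ‖t‖)
    {n m N M : ℕ} {x : Fin n → ℂ} {y : Fin m → ℂ} {z : Fin N → ℂ} {w : Fin M → ℂ}
    (hΦ : KernelRegular q t x y z w) (hr : NSRegular q x y) (hr' : NSRegular q z w)
    (h : Summable (nsGenTerm q t u (fun x' y' => kernelFun q t x' y' z w) x y))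
    (h' : Summable (nsGenTerm q t u (fun z' w' => kernelFun q t x y z' w') z w)) :
    nsGenRenorm q t u (fun x' y' => kernelFun q t x' y' z w) x y
      = nsGenRenorm q t u (fun z' w' => kernelFun q t x y z' w') z w := by
  have h1 := (hasValue_qPochSeries hq1 (t ^ (1 - (n : ℤ)) * q ^ m) u).mul (hasValue_nsSeries h)
  have h2 := (hasValue_qPochSeries hq1 (t ^ (1 - (N : ℤ)) * q ^ M) u).mul (hasValue_nsSeries h')
  rw [nsSeries_identity hq0 hq1 ht hΦ hr hr'] at h1
  have := HasSum.unique h1 h2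
  rw [nsGenRenorm, nsGenRenorm, div_mul_eq_mul_div, div_mul_eq_mul_div, this]

/-- Interchanging the two kinds of variables and inverting the parameters preserves the kernel
function. -/
theorem kernelFun_dual (q t : ℂ) {n m N M : ℕ} (x : Fin n → ℂ) (y : Fin m → ℂ)
    (z : Fin N → ℂ) (w : Fin M → ℂ) :
    kernelFun t⁻¹ q⁻¹ y x w z = kernelFun q t x y z w := by
  unfold kernelFun
  rw [inv_inv]
  ring

/-- The parameter `t^{1-n} q^m` of the NS operators becomes `q^m t^{-n}` under the substitution that
gives the MR operators. -/
theorem dual_parameter {q : ℂ} (t : ℂ) (hq0 : q ≠ 0) (n m : ℕ) :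
    q * (q⁻¹ ^ (1 - (m : ℤ)) * t⁻¹ ^ n) = q ^ m * t ^ (-(n : ℤ)) := by
  rw [inv_zpow', neg_sub, zpow_sub₀ hq0, zpow_natCast, zpow_one, zpow_neg, zpow_natCast, inv_pow]
  field_simp

theorem rescale_qPochSeries_dual {q : ℂ} (t : ℂ) (hq0 : q ≠ 0) (ht : ‖t⁻¹‖ < 1) (n m : ℕ) :
    PowerSeries.rescale q (qPochSeries (q⁻¹ ^ (1 - (m : ℤ)) * t⁻¹ ^ n) t⁻¹)
      = qPochSeries (q ^ m * t ^ (-(n : ℤ))) t⁻¹ := by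
  rw [qPochSeries_eq_rescale ht, qPochSeries_eq_rescale ht (q ^ m * t ^ (-(n : ℤ))),
    PowerSeries.rescale_rescale, mul_comm _ q, dual_parameter t hq0]

theorem mainTheorem1 (q t : ℂ) (hq0 : 0 < ‖q‖) (hq1 : ‖q‖ < 1) (ht : 1 < ‖t‖) (n m N M : ℕ)
    (x : Fin n → ℂ) (y : Fin m → ℂ) (z : Fin N → ℂ) (w : Fin M → ℂ)
    (hΦ : KernelRegular q t x y z w) :
    (NSRegular q x y → NSRegular q z w →
      nsSeriesRenorm q t (fun x' y' => kernelFun q t x' y' z w) x y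
          = nsSeriesRenorm q t (fun z' w' => kernelFun q t x y z' w') z w ∧
      ∀ u : ℂ,
        (n ≠ 0 → ‖t ^ (1 - (n : ℤ)) * q ^ m * u‖ < 1) →
        (N ≠ 0 → ‖t ^ (1 - (N : ℤ)) * q ^ M * u‖ < 1) →
        (∀ k : ℕ, t * u * q ^ k ≠ 1) →
        Summable (nsGenTerm q t u (fun x' y' => kernelFun q t x' y' z w) x y) ∧
        Summable (nsGenTerm q t u (fun z' w' => kernelFun q t x y z' w') z w) ∧
        nsGenRenorm q t u (fun x' y' => kernelFun q t x' y' z w) x y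
          = nsGenRenorm q t u (fun z' w' => kernelFun q t x y z' w') z w) ∧
    (NSRegular t⁻¹ y x → NSRegular t⁻¹ w z →
      mrSeriesRenorm q t (fun x' y' => kernelFun q t x' y' z w) x y
          = mrSeriesRenorm q t (fun z' w' => kernelFun q t x y z' w') z w ∧
      ∀ u : ℂ,
        (m ≠ 0 → ‖q ^ m * t ^ (-(n : ℤ)) * u‖ < 1) →
        (M ≠ 0 → ‖q ^ M * t ^ (-(N : ℤ)) * u‖ < 1) →
        (∀ k : ℕ, u * t⁻¹ ^ k ≠ 1) →
        Summable (mrGenTerm q t u (fun x' y' => kernelFun q t x' y' z w) x y) ∧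
        Summable (mrGenTerm q t u (fun z' w' => kernelFun q t x y z' w') z w) ∧
        mrGenRenorm q t u (fun x' y' => kernelFun q t x' y' z w) x y
          = mrGenRenorm q t u (fun z' w' => kernelFun q t x y z' w') z w) := by
  have hq : q ≠ 0 := norm_pos_iff.mp hq0
  have ht0 : t ≠ 0 := norm_pos_iff.mp (zero_lt_one.trans ht)
  have ht' : t⁻¹ ≠ 0 := inv_ne_zero ht0
  have ht1 : ‖t⁻¹‖ < 1 := by rw [norm_inv]; exact inv_lt_one_of_one_lt₀ ht
  have hq' : 1 < ‖q⁻¹‖ := by rw [norm_inv]; exact (one_lt_inv₀ hq0).mpr hq1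
  constructor
  · intro hr hr'
    refine ⟨nsSeriesRenorm_identity hq hq1 ht hΦ hr hr', fun u hu hu' _ => ?_⟩
    have h1 := summable_nsGenTerm hq hq1 z w hr hu
    have h2 := summable_nsGenTerm hq hq1 x y hr' hu'
    simp only [kernelFun_symm q t _ _ x y] at h2
    exact ⟨h1, h2, nsGenRenorm_identity hq hq1 ht hΦ hr hr' h1 h2⟩
  · -- the MR operators are the NS operators with parameters `t⁻¹`, `q⁻¹` and `q u`
    intro hr hr'
    have hΦ' : KernelRegular t⁻¹ q⁻¹ y x w z :=
      ⟨fun i j k => by rw [inv_inv]; exact hΦ.2 i j k,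
        fun i j k => by rw [inv_inv]; exact hΦ.1 i j k⟩
    have e : ∀ (n m : ℕ) (u : ℂ), q⁻¹ ^ (1 - (m : ℤ)) * t⁻¹ ^ n * (q * u)
        = q ^ m * t ^ (-(n : ℤ)) * u := fun n m u => by
      rw [← dual_parameter t hq]; ring
    have e' : ∀ u : ℂ, q⁻¹ * (q * u) = u := fun u => inv_mul_cancel_left₀ hq u
    constructor
    · have h := congrArg (PowerSeries.rescale q) (nsSeries_identity ht' ht1 hq' hΦ' hr hr')
      rw [map_mul, map_mul, rescale_qPochSeries_dual t hq ht1,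
        rescale_qPochSeries_dual t hq ht1] at h
      simp only [kernelFun_dual] at h
      rw [mrSeriesRenorm, mrSeriesRenorm, mrSeries, mrSeries, mul_right_comm, h, mul_right_comm]
    · intro u hu hu' _
      have h1 := summable_nsGenTerm (t := q⁻¹) (u := q * u) ht' ht1 w z hr
        (fun h => by rw [e]; exact hu h)
      have h2 := summable_nsGenTerm (t := q⁻¹) (u := q * u) ht' ht1 y x hr'
        (fun h => by rw [e]; exact hu' h)
      simp only [kernelFun_symm t⁻¹ q⁻¹ _ _ y x] at h2
      have h3 := nsGenRenorm_identity ht' ht1 hq' hΦ' hr hr' h1 h2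
      simp only [nsGenRenorm, e, e', kernelFun_dual] at h1 h2 h3
      exact ⟨h1, h2, h3⟩
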